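/- Let $d\ge 1$, let $\mathcal O$ be either $\mathbb R^d$ or a torus $\mathbb T^d=(\mathbb R/L\mathbb Z)^d$ ($L>0$), let $\nu>0$ and $d<p<\infty$. Let $S^\nu_t=e^{\nu t\Delta}$ be the heat semigroup on $\mathcal O$, acting componentwise on $\mathbb R^d$-valued functions, and let $F(u)=(u\cdot\nabla)u$, with $\nabla u$ the weak gradient. For $u_0\in L^p(\mathcal O,\mathbb R^d)$ and $f\in L^1(0,T';L^p(\mathcal O,\mathbb R^d))$, a *mild solution on $[0,T']$* of the Burgers equation $\partial_t u+(u\cdot\nabla)u=\nu\Delta u+f$, $u(0)=u_0$, is a function $u\in L^\infty(0,T';L^p(\mathcal O,\mathbb R^d))$ such that $F(u)\in L^1(0,T';L^p(\mathcal O,\mathbb R^d))$ and $$u(t)=S^\nu_tu_0-\int_0^tS^\nu_{t-s}\bigl(F(u(s))-f(s)\bigr)\,ds,\qquad t\in[0,T'].$$ Let $0<T_{\max}<T<\infty$, $u_0\in L^p(\mathcal O,\mathbb R^d)$ and $f\in L^\infty\bigl([0,T];L^{2p/3}(\mathcal O,\mathbb R^d)\cap L^p(\mathcal O,\mathbb R^d)\bigr)$.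 Let $u:[0,T_{\max})\to L^p(\mathcal O,\mathbb R^d)$ be a maximal local mild solution with maximal existence time $T_{\max}$; that is, $u$ is a mild solution on $[0,t]$ for every $t\in(0,T_{\max})$, and there is no $T'\in(T_{\max},T]$ such that $u$ extends to a mild solution on $[0,T']$. Then $$\limsup_{t\nearrow T_{\max}}|u(t)|_{L^p(\mathcal O,\mathbb R^d)}^2=\infty .$$ -/

import Mathlib

open MeasureTheory Filter Topology
open scoped ENNReal

namespace Burgers

noncomputable section

/-- Euclidean space `ℝ^d` (with the Euclidean norm). -/
abbrev E (d : ℕ) : Type := EuclideanSpace ℝ (Fin d)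

/-- The flat torus `𝕋^d = (ℝ / Lℤ)^d` of period `L > 0`, with its Lebesgue measure as `volume`. -/
abbrev Torus (d : ℕ) (L : ℝ) : Type := Fin d → AddCircle L

/-- The covering map `ℝ^d → 𝕋^d`. -/
def Torus.proj (d : ℕ) (L : ℝ) (y : E d) : Torus d L := fun i => ((y i : ℝ) : AddCircle L)

/-! Everything below is written for a spatial domain `X` together with a map `q : ℝ^d → X`; it is
used for `X = ℝ^d` with `q = id`, and for `X = 𝕋^d` with the covering map `q`. -/

section Space

variable {d : ℕ} {X : Type} [AddCommGroup X] [TopologicalSpace X]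

/-- Test functions: smooth with compact support (on the torus: all smooth periodic functions). -/
def IsTest (q : E d → X) (φ : X → ℝ) : Prop :=
  ContDiff ℝ ((⊤ : ℕ∞) : WithTop ℕ∞) (fun y => φ (q y)) ∧ HasCompactSupport φ

/-- The classical partial derivative `∂φ/∂x_j`. -/
def partialDeriv (q : E d → X) (j : Fin d) (φ : X → ℝ) (x : X) : ℝ :=
  deriv (fun s : ℝ => φ (x + q (EuclideanSpace.single j s))) 0

variable [MeasureSpace X]

/-- `g` is the weak (distributional) partial derivative `∂h/∂x_j` of the vector field `h`. -/
def IsWeakPartial (q : E d → X) (j : Fin d) (h g : X → E d) : Prop :=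
  LocallyIntegrable h (volume : Measure X) ∧ LocallyIntegrable g (volume : Measure X) ∧
    ∀ φ : X → ℝ, IsTest q φ →
      ∫ x, φ x • g x = - ∫ x, partialDeriv q j φ x • h x

/-- `w = F(a, b) = (a · ∇) b`, that is `w = ∑ j, a^j ∂b/∂x_j` almost everywhere, where the partial
derivatives of `b` exist in the weak sense (they are then unique up to null sets). -/
def IsAdvection (q : E d → X) (a b w : X → E d) : Prop :=
  ∃ g : Fin d → X → E d, (∀ j, IsWeakPartial q j b (g j)) ∧
    w =ᵐ[volume] fun x => ∑ j, a x j • g j x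

end Space

/-- The Gauss-Weierstrass kernel of `e^{ν t Δ}` on `ℝ^d`, for `t > 0`. -/
def heatKernel (d : ℕ) (ν t : ℝ) (y : E d) : ℝ :=
  (4 * Real.pi * ν * t) ^ (-((d : ℝ) / 2)) * Real.exp (-(‖y‖ ^ 2) / (4 * ν * t))

section Semigroup

variable {d : ℕ} {X : Type} [AddCommGroup X] [MeasureSpace X] [MeasurableAdd X]
  [(volume : Measure X).IsAddRightInvariant] {p : ℝ≥0∞}

/-- The translate `x ↦ h (x - a)` of `h ∈ L^p(X; ℝ^d)`. -/
def translate (a : X) (h : Lp (E d) p (volume : Measure X)) : Lp (E d) p (volume : Measure X) :=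
  Lp.compMeasurePreserving (fun x => x - a)
    (by simpa only [sub_eq_add_neg] using measurePreserving_add_right (volume : Measure X) (-a)) h

variable [Fact (1 ≤ p)]

/-- The heat semigroup `S_t^ν = e^{ν t Δ}` on `L^p(X; ℝ^d)`, acting componentwise:
`(S_t^ν h)(x) = ∫ G_{νt}(y) h(x - q y) dy` over `y ∈ ℝ^d` for `t > 0` (an `L^p`-valued Bochner
integral of translates of `h`), and `S_0^ν h = h`. On the torus this is the convolution with the
periodized kernel. -/
def heat (q : E d → X) (ν t : ℝ) (h : Lp (E d) p (volume : Measure X)) :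
    Lp (E d) p (volume : Measure X) :=
  if t ≤ 0 then h else ∫ y : E d, heatKernel d ν t y • translate (q y) h

variable [TopologicalSpace X]

/-- `u ∈ L^∞(0, T; L^p)` is a mild solution on `[0, T]` of the Burgers equation with viscosity `ν`,
initial condition `u₀ ∈ L^p` and force `f ∈ L^1(0, T; L^p)`: `w = F(u) = (u · ∇) u` lies in
`L^1(0, T; L^p)` and `u(t) = S_t u₀ - ∫_0^t S_{t-s} (F(u(s)) - f(s)) ds` for all `t ∈ [0, T]`. -/
def IsMildSolution (q : E d → X) (ν : ℝ) (u₀ : Lp (E d) p (volume : Measure X))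
    (f : ℝ → Lp (E d) p (volume : Measure X)) (T : ℝ)
    (u : ℝ → Lp (E d) p (volume : Measure X)) : Prop :=
  IntegrableOn f (Set.Ioc 0 T) ∧
  MemLp u ∞ (volume.restrict (Set.Ioc 0 T)) ∧
  ∃ w : ℝ → Lp (E d) p (volume : Measure X),
    IntegrableOn w (Set.Ioc 0 T) ∧
    (∀ᵐ s ∂(volume.restrict (Set.Ioc 0 T)), IsAdvection q (u s) (u s) (w s)) ∧
    ∀ t ∈ Set.Icc 0 T,
      u t = heat q ν t u₀ - ∫ s in (0 : ℝ)..t, heat q ν (t - s) (w s - f s)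

/-- For a force given on `[0, T]`, `u` is a maximal local mild solution with maximal existence time
`Tmax`: it is a mild solution on `[0, t]` for every `t < Tmax`, and it does not extend to a mild
solution on a longer interval `[0, T']`, `Tmax < T' ≤ T`. Only the values of `u` on `[0, Tmax)`
matter. -/
def IsMaximalMildSolution (q : E d → X) (ν : ℝ) (u₀ : Lp (E d) p (volume : Measure X))
    (T : ℝ) (f : ℝ → Lp (E d) p (volume : Measure X)) (Tmax : ℝ)
    (u : ℝ → Lp (E d) p (volume : Measure X)) : Prop :=
  0 < Tmax ∧
  (∀ t, 0 < t → t < Tmax → IsMildSolution q ν u₀ f t u) ∧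
  ¬ ∃ T' : ℝ, Tmax < T' ∧ T' ≤ T ∧ ∃ v : ℝ → Lp (E d) p (volume : Measure X),
    Set.EqOn v u (Set.Ico 0 Tmax) ∧ IsMildSolution q ν u₀ f T' v

end Semigroup

/-- `f ∈ L^∞([0, T]; L^r(X; ℝ^d) ∩ L^p(X; ℝ^d))`. -/
def IsBoundedForce {d : ℕ} {X : Type} [MeasureSpace X] {p : ℝ≥0∞} [Fact (1 ≤ p)] (r : ℝ≥0∞) (T : ℝ)
    (f : ℝ → Lp (E d) p (volume : Measure X)) : Prop :=
  MemLp f ∞ (volume.restrict (Set.Ioc 0 T)) ∧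
  ∃ C : ℝ, ∀ᵐ t ∂(volume.restrict (Set.Ioc 0 T)),
    eLpNorm (f t) r (volume : Measure X) ≤ ENNReal.ofReal C

end

end Burgers

set_option linter.unusedSectionVars false

/-! The unknown that is controlled is not `u` but its nonlinearity w = F(u), as an element of L¹ in
time with values in L^p. Both `u` and its gradient are Duhamel integrals of g = f - w, so w solves
the closed equation w = B(v, ∇v), where B(a, b) = ∑ⱼ aʲ bⱼ maps L^∞ × (L^p)^d to L^p, and v and ∇v
are obtained from g by the heat semigroup and its gradient. The semigroup maps L^p to L^∞ with norm
O(t^(-d/2p)) for t ≤ 1 (`exists_heat_Linfty`), and its gradient acts on L^p with norm O(t^(-1/2)).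
For d < p the two exponents add up to less than 1.

Hence the bilinear estimate `bilinear_duhamel`: on an interval of length τ, ∫‖B(v, ∇v)‖ is at most a
constant times τ^(1/2 - d/2p) (‖v(0)‖ + ∫‖g‖)². It is used twice. Suppose that the limsup is finite,
so that ‖u‖ ≤ M near `Tmax`.

A priori bound (`integrableOn_nonlinearity`): after a restart at t₀ close to `Tmax`, the estimate
shows that ∫‖w‖ from t₀ on stays below 1/2 as long as it stays below 1. By continuity it stays below
1 up to `Tmax`, so w is integrable up to `Tmax`.

Continuation (`exists_extension`): the Duhamel formula then has a value at `Tmax`. From this value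
the equation for w is solved on a short interval by contraction in L¹ (`exists_duhamel_fixedPoint`).
Gluing the two nonlinearities gives a mild solution beyond `Tmax`, against maximality.

Whole space and torus are treated together: all that is needed of the map q : ℝ^d → X is collected
in `IsDomainMap`. -/

namespace Burgers

noncomputable section

/-! ### The Gauss-Weierstrass kernel. -/

section Gaussian

variable {d : ℕ} {ν : ℝ}

lemma continuous_heatKernel (t : ℝ) : Continuous (heatKernel d ν t) := by
  unfold heatKernel
  fun_prop

lemma heatKernel_nonneg (hν : 0 < ν) {t : ℝ} (ht : 0 < t) (y : E d) : 0 ≤ heatKernel d ν t y := by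
  unfold heatKernel
  positivity

lemma integrable_exp_neg_mul_sq {b : ℝ} (hb : 0 < b) :
    Integrable (fun y : E d => Real.exp (-b * ‖y‖ ^ 2)) := by
  by_contra h
  have h1 := GaussianFourier.integral_rexp_neg_mul_sq_norm (V := E d) hb
  rw [integral_undef h] at h1
  have : 0 < (Real.pi / b) ^ ((Module.finrank ℝ (E d) : ℝ) / 2) := by positivity
  exact this.ne h1

lemma heatKernel_eq (t : ℝ) (y : E d) : heatKernel d ν t y =
    (4 * Real.pi * ν * t) ^ (-((d : ℝ) / 2)) * Real.exp (-(1 / (4 * ν * t)) * ‖y‖ ^ 2) := by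
  unfold heatKernel
  congr 2
  ring

lemma integrable_heatKernel (hν : 0 < ν) {t : ℝ} (ht : 0 < t) : Integrable (heatKernel d ν t) := by
  have : heatKernel d ν t = fun y =>
    (4 * Real.pi * ν * t) ^ (-((d : ℝ) / 2)) * Real.exp (-(1 / (4 * ν * t)) * ‖y‖ ^ 2) :=
    funext (heatKernel_eq t)
  rw [this]
  exact (integrable_exp_neg_mul_sq (by positivity)).const_mul _

lemma integral_heatKernel (hν : 0 < ν) {t : ℝ} (ht : 0 < t) : ∫ y, heatKernel d ν t y = 1 := by
  simp_rw [heatKernel_eq]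
  rw [integral_const_mul, GaussianFourier.integral_rexp_neg_mul_sq_norm (by positivity),
    finrank_euclideanSpace_fin, show Real.pi / (1 / (4 * ν * t)) = 4 * Real.pi * ν * t by
      field_simp, Real.rpow_neg (by positivity), inv_mul_cancel₀ (by positivity)]

lemma heatKernel_sqrt_smul (hν : 0 < ν) {t : ℝ} (ht : 0 < t) (z : E d) :
    heatKernel d ν t (√t • z) = t ^ (-((d : ℝ) / 2)) * heatKernel d ν 1 z := by
  unfold heatKernel
  rw [mul_one, Real.mul_rpow (by positivity) ht.le, norm_smul, mul_pow, Real.norm_eq_abs,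
    sq_abs, Real.sq_sqrt ht.le]
  rw [show -(t * ‖z‖ ^ 2) / (4 * ν * t) = -‖z‖ ^ 2 / (4 * ν * 1) by field_simp]
  ring

/-- The source of the smoothing rate: the p-th root of the factor t^(-d/2) is t^(-d/2p). -/
lemma heatKernel_le (hν : 0 < ν) {t : ℝ} (ht : 0 < t) (ht1 : t ≤ 1) (z : E d) :
    heatKernel d ν t z ≤ t ^ (-((d : ℝ) / 2)) * heatKernel d ν 1 z := by
  unfold heatKernel
  rw [mul_one, Real.mul_rpow (by positivity) ht.le]
  have : -‖z‖ ^ 2 / (4 * ν * t) ≤ -‖z‖ ^ 2 / (4 * ν * 1) := by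
    rw [neg_div, neg_div, neg_le_neg_iff]
    gcongr
  calc _ ≤ (4 * Real.pi * ν) ^ (-((d : ℝ) / 2)) * t ^ (-((d : ℝ) / 2)) *
        Real.exp (-‖z‖ ^ 2 / (4 * ν * 1)) := by gcongr
    _ = _ := by ring

/-- The partial derivative `∂_j` of the heat kernel at time `1`. -/
def heatKernelDeriv (d : ℕ) (ν : ℝ) (j : Fin d) (z : E d) : ℝ :=
  -(z j / (2 * ν)) * heatKernel d ν 1 z

lemma hasLineDerivAt_heatKernel (hν : 0 < ν) (j : Fin d) (z : E d) :
    HasLineDerivAt ℝ (heatKernel d ν 1) (heatKernelDeriv d ν j z) z (EuclideanSpace.single j 1) := by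
  have h1 : HasFDerivAt (fun z : E d => ‖z‖ ^ 2) _ z := (hasStrictFDerivAt_norm_sq z).hasFDerivAt
  have h2 := ((h1.neg.mul_const (1 / (4 * ν * 1))).exp).const_mul
    ((4 * Real.pi * ν * 1) ^ (-((d : ℝ) / 2)))
  have h3 := h2.hasLineDerivAt (EuclideanSpace.single j 1)
  have h4 : heatKernel d ν 1 = fun y => (4 * Real.pi * ν * 1) ^ (-((d : ℝ) / 2)) *
      Real.exp ((-fun z => ‖z‖ ^ 2) y * (1 / (4 * ν * 1))) := by
    ext y
    simp only [heatKernel, Pi.neg_apply]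
    congr 2
    ring
  rw [h4]
  convert! h3 using 1
  simp [heatKernelDeriv, h4, EuclideanSpace.inner_single_right]
  field_simp
  ring

/-- The Gaussian is split into two equal factors. One absorbs the linear factor `z j`, at the cost
of the constant 1 + 8ν, and the other remains integrable. -/
lemma integrable_heatKernelDeriv (hν : 0 < ν) (j : Fin d) :
    Integrable (heatKernelDeriv d ν j) := by
  have hb : 0 < 1 / (8 * ν) := by positivity
  have h1 := (integrable_exp_neg_mul_sq (d := d) hb).const_mul
    ((4 * Real.pi * ν * 1) ^ (-((d : ℝ) / 2)) * (1 / (2 * ν)) * (1 + 8 * ν))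
  refine h1.mono' ?_ (Eventually.of_forall fun z => ?_)
  · unfold heatKernelDeriv
    have := continuous_heatKernel (d := d) (ν := ν) 1
    exact (by fun_prop : Continuous _).aestronglyMeasurable
  · unfold heatKernelDeriv
    rw [norm_mul, Real.norm_of_nonneg (heatKernel_nonneg hν one_pos z), heatKernel_eq, norm_neg,
      norm_div, Real.norm_of_nonneg (by positivity : 0 ≤ 2 * ν)]
    have hz : ‖z j‖ ≤ ‖z‖ := PiLp.norm_apply_le z j
    have h2 : ‖z‖ ≤ (1 + 8 * ν) * Real.exp (1 / (8 * ν) * ‖z‖ ^ 2) := by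
      have h3 : 1 / (8 * ν) * ‖z‖ ^ 2 + 1 ≤ Real.exp (1 / (8 * ν) * ‖z‖ ^ 2) :=
        Real.add_one_le_exp _
      have h4 : ‖z‖ ≤ (1 + 8 * ν) * (1 / (8 * ν) * ‖z‖ ^ 2 + 1) := by
        have : (1 + 8 * ν) * (1 / (8 * ν) * ‖z‖ ^ 2 + 1) =
          1 / (8 * ν) * ‖z‖ ^ 2 + ‖z‖ ^ 2 + 1 + 8 * ν := by field_simp; ring
        rw [this]
        have : 0 ≤ 1 / (8 * ν) * ‖z‖ ^ 2 := by positivity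
        nlinarith [sq_nonneg (‖z‖ - 1)]
      exact h4.trans (by gcongr)
    have h5 : Real.exp (-(1 / (4 * ν * 1)) * ‖z‖ ^ 2) =
        Real.exp (-(1 / (8 * ν)) * ‖z‖ ^ 2) * Real.exp (-(1 / (8 * ν)) * ‖z‖ ^ 2) := by
      rw [← Real.exp_add]; congr 1; field_simp; ring
    have h6 : Real.exp (1 / (8 * ν) * ‖z‖ ^ 2) * Real.exp (-(1 / (8 * ν)) * ‖z‖ ^ 2) = 1 := by
      rw [← Real.exp_add]; simp
    rw [h5]
    set e := Real.exp (-(1 / (8 * ν)) * ‖z‖ ^ 2) with he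
    have he0 : 0 < e := Real.exp_pos _
    have h7 : ‖z j‖ * e ≤ 1 + 8 * ν := by
      calc ‖z j‖ * e ≤ (1 + 8 * ν) * Real.exp (1 / (8 * ν) * ‖z‖ ^ 2) * e := by
            gcongr; exact hz.trans h2
        _ = _ := by rw [mul_assoc, h6, mul_one]
    calc _ = (4 * Real.pi * ν * 1) ^ (-((d : ℝ) / 2)) * (1 / (2 * ν)) * (‖z j‖ * e) * e := by ring
      _ ≤ _ := by gcongr

lemma integrable_heatKernel_mul (hν : 0 < ν) {s t : ℝ} (hs : 0 < s) (ht : 0 < t) :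
    Integrable (fun x : E d × E d => heatKernel d ν s x.1 * heatKernel d ν t x.2) :=
  (integrable_heatKernel hν hs).mul_prod (integrable_heatKernel hν ht)

/-- Completing the square in y: the integrand is the kernel of time s + t at z times a kernel of
time st/(s + t) centred at (s/(s + t)) z, and the latter has mass one. -/
lemma integral_heatKernel_mul_heatKernel_sub (hν : 0 < ν) {s t : ℝ} (hs : 0 < s) (ht : 0 < t)
    (z : E d) :
    ∫ y, heatKernel d ν s y * heatKernel d ν t (z - y) = heatKernel d ν (s + t) z := by
  have h1 : ∀ y : E d, heatKernel d ν s y * heatKernel d ν t (z - y) =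
      heatKernel d ν (s + t) z * heatKernel d ν (s * t / (s + t)) (y - (s / (s + t)) • z) := by
    intro y
    unfold heatKernel
    have e1 : ‖z - y‖ ^ 2 = ‖z‖ ^ 2 - 2 * inner ℝ z y + ‖y‖ ^ 2 := norm_sub_sq_real z y
    have e2 : ‖y - (s / (s + t)) • z‖ ^ 2 =
        ‖y‖ ^ 2 - 2 * (s / (s + t)) * inner ℝ z y + (s / (s + t)) ^ 2 * ‖z‖ ^ 2 := by
      rw [norm_sub_sq_real, inner_smul_right, norm_smul, mul_pow, Real.norm_eq_abs, sq_abs,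
        real_inner_comm]; ring
    have e3 : (4 * Real.pi * ν * s) ^ (-((d : ℝ) / 2)) * (4 * Real.pi * ν * t) ^ (-((d : ℝ) / 2)) =
        (4 * Real.pi * ν * (s + t)) ^ (-((d : ℝ) / 2)) *
          (4 * Real.pi * ν * (s * t / (s + t))) ^ (-((d : ℝ) / 2)) := by
      rw [← Real.mul_rpow (by positivity) (by positivity),
        ← Real.mul_rpow (by positivity) (by positivity)]
      congr 1; field_simp
    have e4 : Real.exp (-‖y‖ ^ 2 / (4 * ν * s)) * Real.exp (-‖z - y‖ ^ 2 / (4 * ν * t)) =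
        Real.exp (-‖z‖ ^ 2 / (4 * ν * (s + t))) *
          Real.exp (-‖y - (s / (s + t)) • z‖ ^ 2 / (4 * ν * (s * t / (s + t)))) := by
      rw [← Real.exp_add, ← Real.exp_add, e1, e2]
      congr 1; field_simp; ring
    calc _ = ((4 * Real.pi * ν * s) ^ (-((d : ℝ) / 2)) * (4 * Real.pi * ν * t) ^ (-((d : ℝ) / 2))) *
          (Real.exp (-‖y‖ ^ 2 / (4 * ν * s)) * Real.exp (-‖z - y‖ ^ 2 / (4 * ν * t))) := by ring
      _ = _ := by rw [e3, e4]; ring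
  simp_rw [h1]
  rw [integral_const_mul, integral_sub_right_eq_self (heatKernel d ν (s * t / (s + t))),
    integral_heatKernel hν (by positivity), mul_one]

end Gaussian

/-! ### Averages of translates on L^p and the heat semigroup. -/

section Averages

variable {d : ℕ} {X : Type} [AddCommGroup X] [TopologicalSpace X] [IsTopologicalAddGroup X]
  [T2Space X] [SecondCountableTopology X] [LocallyCompactSpace X] [MeasureSpace X] [BorelSpace X]
  [IsLocallyFiniteMeasure (volume : Measure X)] [(volume : Measure X).IsAddRightInvariant]
  {p : ℝ≥0∞} {q : E d → X} {ν : ℝ}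

lemma coeFn_translate (a : X) (h : Lp (E d) p (volume : Measure X)) :
    translate a h =ᵐ[volume] fun x => h (x - a) :=
  Lp.coeFn_compMeasurePreserving _ _

lemma norm_translate (a : X) (h : Lp (E d) p (volume : Measure X)) : ‖translate a h‖ = ‖h‖ :=
  Lp.norm_compMeasurePreserving _ _

lemma translate_add (a : X) (h g : Lp (E d) p (volume : Measure X)) :
    translate a (h + g) = translate a h + translate a g :=
  map_add (Lp.compMeasurePreserving _ _) h g

lemma translate_zero (h : Lp (E d) p (volume : Measure X)) : translate 0 h = h := by
  apply Lp.ext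
  filter_upwards [coeFn_translate 0 h] with x hx
  simpa using hx

lemma translate_translate (a b : X) (h : Lp (E d) p (volume : Measure X)) :
    translate a (translate b h) = translate (a + b) h := by
  apply Lp.ext
  have h1 := (measurePreserving_sub_right (volume : Measure X) a).quasiMeasurePreserving.ae
    (coeFn_translate b h)
  filter_upwards [coeFn_translate a (translate b h), coeFn_translate (a + b) h, h1] with x h2 h3 h4
  rw [h2, h3, h4, sub_sub]

variable [Fact (1 ≤ p)]

lemma translate_smul (a : X) (c : ℝ) (h : Lp (E d) p (volume : Measure X)) :
    translate a (c • h) = c • translate a h :=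
  map_smul (Lp.compMeasurePreservingₗᵢ ℝ _ _) c h

/-- Translation as a bounded operator on `L^p`. -/
def translateL (a : X) : Lp (E d) p (volume : Measure X) →L[ℝ] Lp (E d) p (volume : Measure X) :=
  LinearMap.mkContinuous
    { toFun := translate a, map_add' := translate_add a, map_smul' := translate_smul a } 1
    fun h => by simp [norm_translate]

lemma continuous_translate (hp : p ≠ ∞) :
    Continuous fun x : X × Lp (E d) p (volume : Measure X) => translate x.1 x.2 := by
  have hg : Continuous fun x : X × Lp (E d) p (volume : Measure X) =>
      (⟨fun y => y - x.1, by fun_prop⟩ : C(X, X)) :=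
    ContinuousMap.continuous_of_continuous_uncurry _
      (continuous_snd.sub (continuous_fst.comp continuous_fst))
  exact Continuous.compMeasurePreservingLp continuous_snd hg
    (fun x => by
      simpa only [sub_eq_add_neg, ContinuousMap.coe_mk] using
        measurePreserving_add_right volume (-x.1)) hp

lemma integrable_smul_translate (hp : p ≠ ∞) {Y : Type*} [TopologicalSpace Y] [MeasurableSpace Y]
    [OpensMeasurableSpace Y] [SecondCountableTopology Y] {μ : Measure Y}
    {r : Y → X} (hr : Continuous r) {k : Y → ℝ} (hk : Integrable k μ)
    (h : Lp (E d) p (volume : Measure X)) :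
    Integrable (fun z => k z • translate (r z) h) μ := by
  refine (hk.norm.mul_const ‖h‖).mono' ?_ (Eventually.of_forall fun z => ?_)
  · have : Continuous fun z => translate (r z) h :=
      (continuous_translate hp).comp (hr.prodMk continuous_const)
    exact hk.aestronglyMeasurable.smul this.aestronglyMeasurable
  · rw [norm_smul, norm_translate]

/-- The average `h ↦ ∫ k(z) h(· - q(√t z)) dz` of translates of `h ∈ L^p`. -/
def average (hp : p ≠ ∞) (hq : Continuous q) {k : E d → ℝ} (hk : Integrable k) (t : ℝ) :
    Lp (E d) p (volume : Measure X) →L[ℝ] Lp (E d) p (volume : Measure X) :=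
  LinearMap.mkContinuous
    { toFun := fun h => ∫ z, k z • translate (q (√t • z)) h
      map_add' := fun h g => by
        have hr : Continuous fun z => q (√t • z) := by fun_prop
        simp_rw [translate_add, smul_add]
        exact integral_add (integrable_smul_translate hp hr hk h)
          (integrable_smul_translate hp hr hk g)
      map_smul' := fun c h => by
        simp_rw [translate_smul, smul_comm _ c]
        exact integral_smul c _ } (∫ z, ‖k z‖)
    fun h => by
      refine (norm_integral_le_integral_norm _).trans_eq ?_
      simp_rw [norm_smul, norm_translate]
      exact integral_mul_const _ _

lemma average_apply (hp : p ≠ ∞) (hq : Continuous q) {k : E d → ℝ} (hk : Integrable k) (t : ℝ)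
    (h : Lp (E d) p (volume : Measure X)) :
    average hp hq hk t h = ∫ z, k z • translate (q (√t • z)) h := rfl

lemma norm_average_le (hp : p ≠ ∞) (hq : Continuous q) {k : E d → ℝ} (hk : Integrable k) (t : ℝ) :
    ‖(average hp hq hk t : Lp (E d) p (volume : Measure X) →L[ℝ] _)‖ ≤ ∫ z, ‖k z‖ :=
  LinearMap.mkContinuous_norm_le _ (integral_nonneg fun _ => norm_nonneg _) _

/-- Time enters only through √t z, against a fixed weight `k`. Dominated convergence therefore gives
joint continuity also at t = 0, where the kernel itself degenerates. -/
lemma continuous_average (hp : p ≠ ∞) (hq : Continuous q) {k : E d → ℝ} (hk : Integrable k) :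
    Continuous fun x : ℝ × Lp (E d) p (volume : Measure X) => average hp hq hk x.1 x.2 := by
  rw [continuous_iff_continuousAt]
  rintro ⟨t, h⟩
  simp_rw [average_apply]
  refine continuousAt_of_dominated (bound := fun z => ‖k z‖ * (‖h‖ + 1))
    (Eventually.of_forall fun x => ?_) ?_ (hk.norm.mul_const _) (Eventually.of_forall fun z => ?_)
  · exact (integrable_smul_translate hp (by fun_prop) hk x.2).aestronglyMeasurable
  · have : ∀ᶠ x : ℝ × Lp (E d) p (volume : Measure X) in 𝓝 (t, h), ‖x.2‖ < ‖h‖ + 1 :=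
      continuous_snd.norm.continuousAt.eventually_lt_const (lt_add_one ‖h‖)
    filter_upwards [this] with x hx
    refine Eventually.of_forall fun z => ?_
    rw [norm_smul, norm_translate]
    gcongr
  · refine Continuous.continuousAt ?_
    refine Continuous.const_smul (c := k z)
      ((continuous_translate (d := d) (p := p) hp).comp (Continuous.prodMk ?_ continuous_snd))
    have := Real.continuous_sqrt
    fun_prop

/-- The heat semigroup as a family of bounded operators on `L^p`. -/
def heatL (hp : p ≠ ∞) (hq : Continuous q) (hν : 0 < ν) (t : ℝ) :
    Lp (E d) p (volume : Measure X) →L[ℝ] Lp (E d) p (volume : Measure X) :=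
  average hp hq (integrable_heatKernel hν one_pos) t

lemma continuous_heatL (hp : p ≠ ∞) (hq : Continuous q) (hν : 0 < ν) :
    Continuous fun x : ℝ × Lp (E d) p (volume : Measure X) => heatL hp hq hν x.1 x.2 :=
  continuous_average hp hq _

/-- The real square root vanishes on t ≤ 0, so the rescaled formula agrees with the default value in
`heat`. -/
lemma heatL_of_nonpos (hp : p ≠ ∞) (hq : Continuous q) (hq0 : q 0 = 0) (hν : 0 < ν) {t : ℝ}
    (ht : t ≤ 0) (h : Lp (E d) p (volume : Measure X)) : heatL hp hq hν t h = h := by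
  rw [heatL, average_apply, Real.sqrt_eq_zero_of_nonpos ht]
  simp_rw [zero_smul, hq0, translate_zero]
  rw [integral_smul_const, integral_heatKernel hν one_pos, one_smul]

/-- Substitution y = √t z: the Jacobian cancels against the parabolic scaling of the kernel. -/
lemma heatL_of_pos (hp : p ≠ ∞) (hq : Continuous q) (hν : 0 < ν) {t : ℝ}
    (ht : 0 < t) (h : Lp (E d) p (volume : Measure X)) :
    heatL hp hq hν t h = ∫ y, heatKernel d ν t y • translate (q y) h := by
  rw [heatL, average_apply]
  have h1 := Measure.integral_comp_smul (volume : Measure (E d))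
    (fun y => heatKernel d ν t y • translate (q y) h) (√t)
  simp_rw [heatKernel_sqrt_smul hν ht, mul_smul] at h1
  rw [integral_smul, finrank_euclideanSpace_fin] at h1
  have h2 : |(√t ^ d)⁻¹| = t ^ (-((d : ℝ) / 2)) := by
    rw [abs_of_nonneg (by positivity), Real.rpow_neg ht.le, Real.sqrt_eq_rpow, ← Real.rpow_natCast,
      ← Real.rpow_mul ht.le]
    congr 2; ring
  rw [h2] at h1
  exact smul_right_injective _ (by positivity : t ^ (-((d : ℝ) / 2)) ≠ 0) h1

lemma heat_eq_heatL (hp : p ≠ ∞) (hq : Continuous q) (hq0 : q 0 = 0) (hν : 0 < ν) (t : ℝ)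
    (h : Lp (E d) p (volume : Measure X)) : heat q ν t h = heatL hp hq hν t h := by
  unfold heat
  split_ifs with ht
  · rw [heatL_of_nonpos hp hq hq0 hν ht]
  · rw [heatL_of_pos hp hq hν (not_le.1 ht)]

lemma norm_heatL_le (hp : p ≠ ∞) (hq : Continuous q) (hν : 0 < ν) (t : ℝ) :
    ‖(heatL hp hq hν t : Lp (E d) p (volume : Measure X) →L[ℝ] _)‖ ≤ 1 := by
  refine (norm_average_le hp hq _ t).trans_eq ?_
  simp_rw [Real.norm_of_nonneg (heatKernel_nonneg hν one_pos _)]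
  exact integral_heatKernel hν one_pos

lemma heatL_heatL (hp : p ≠ ∞) (hq : Continuous q) (hqa : ∀ y z, q (y + z) = q y + q z)
    (hν : 0 < ν) {s t : ℝ} (hs : 0 ≤ s) (ht : 0 ≤ t) (h : Lp (E d) p (volume : Measure X)) :
    heatL hp hq hν s (heatL hp hq hν t h) = heatL hp hq hν (s + t) h := by
  have hq0 : q 0 = 0 := by simpa using hqa 0 0
  rcases hs.eq_or_lt with rfl | hs
  · rw [heatL_of_nonpos hp hq hq0 hν le_rfl, zero_add]
  rcases ht.eq_or_lt with rfl | ht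
  · rw [heatL_of_nonpos hp hq hq0 hν le_rfl, add_zero]
  have hint : Integrable (fun x : E d × E d =>
      (heatKernel d ν s x.1 * heatKernel d ν t x.2) • translate (q (x.1 + x.2)) h) :=
    integrable_smul_translate hp (by fun_prop) (integrable_heatKernel_mul hν hs ht) h
  -- The shear turns the double integral over (y, z) with translation by y + z into one where the
  -- translate depends on a single variable. Fubini then leaves a convolution of kernels.
  have hshear : MeasurePreserving (fun x : E d × E d => (x.1, x.2 - x.1)) :=
    measurePreserving_prod_sub volume volume
  have hint2 : Integrable (fun x : E d × E d =>
      (heatKernel d ν s x.1 * heatKernel d ν t (x.2 - x.1)) • translate (q x.2) h) := by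
    have := hshear.integrable_comp_of_integrable hint
    simpa [Function.comp_def] using this
  calc heatL hp hq hν s (heatL hp hq hν t h)
      = ∫ y, ∫ z, (heatKernel d ν s y * heatKernel d ν t (z - y)) • translate (q z) h := by
        rw [heatL_of_pos hp hq hν hs]
        congr 1 with y : 1
        have h1 : translate (q y) (heatL hp hq hν t h) =
            ∫ z, heatKernel d ν t z • translate (q (y + z)) h := by
          rw [heatL_of_pos hp hq hν ht]
          change translateL (q y) _ = _
          rw [← ContinuousLinearMap.integral_comp_comm _
            (integrable_smul_translate hp hq (integrable_heatKernel hν ht) h)]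
          congr 1 with z : 1
          rw [map_smul]
          change _ • translate _ _ = _
          rw [translate_translate, hqa]
        rw [h1, ← integral_smul, ← integral_sub_right_eq_self _ y]
        simp_rw [smul_smul, add_sub_cancel]
    _ = ∫ z, ∫ y, (heatKernel d ν s y * heatKernel d ν t (z - y)) • translate (q z) h :=
        integral_integral_swap hint2
    _ = heatL hp hq hν (s + t) h := by
        rw [heatL_of_pos hp hq hν (by positivity)]
        congr 1 with z : 1
        rw [integral_smul_const, integral_heatKernel_mul_heatKernel_sub hν hs ht]

end Averages

/-! ### Domains covered by ℝ^d, and weak derivatives of the heat flow. -/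

/-- The properties of the map `q : ℝ^d → X` shared by `ℝ^d` and the torus: it is an open continuous
surjective homomorphism, measure non-increasing on some bounded set of positive measure, and test
functions separate locally integrable functions. -/
structure IsDomainMap {d : ℕ} {X : Type} [AddCommGroup X] [TopologicalSpace X] [MeasureSpace X]
    (q : E d → X) : Prop where
  map_add : ∀ y z, q (y + z) = q y + q z
  isOpenQuotientMap : IsOpenQuotientMap q
  exists_cell : ∃ B : Set (E d), MeasurableSet B ∧ Bornology.IsBounded B ∧ volume B ≠ 0 ∧
    ∀ H : X → ℝ≥0∞, Measurable H → ∫⁻ z in B, H (q z) ≤ ∫⁻ x, H x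
  ae_eq_zero : ∀ h : X → E d, LocallyIntegrable h (volume : Measure X) →
    (∀ φ : X → ℝ, IsTest q φ → ∫ x, φ x • h x = 0) → h =ᵐ[volume] 0

section WeakDerivative

variable {d : ℕ} {X : Type} [AddCommGroup X] [TopologicalSpace X] [IsTopologicalAddGroup X]
  [T2Space X] [SecondCountableTopology X] [LocallyCompactSpace X] [MeasureSpace X] [BorelSpace X]
  [IsLocallyFiniteMeasure (volume : Measure X)] [(volume : Measure X).IsAddRightInvariant]
  {p : ℝ≥0∞} {q : E d → X} {ν : ℝ} {j : Fin d} {φ : X → ℝ}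

lemma IsDomainMap.continuous (hq : IsDomainMap q) : Continuous q := hq.isOpenQuotientMap.continuous

lemma IsDomainMap.map_zero (hq : IsDomainMap q) : q 0 = 0 := by simpa using hq.map_add 0 0

lemma IsTest.continuous (hq : IsDomainMap q) (hφ : IsTest q φ) : Continuous φ :=
  hq.isOpenQuotientMap.continuous_comp_iff.1 hφ.1.continuous

lemma single_eq_smul (j : Fin d) (s : ℝ) :
    (EuclideanSpace.single j s : E d) = s • EuclideanSpace.single j (1 : ℝ) := by
  ext i
  rcases eq_or_ne i j with rfl | hi
  · simp
  · simp [hi]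

lemma single_zero (j : Fin d) : (EuclideanSpace.single j (0 : ℝ) : E d) = 0 := by
  rw [single_eq_smul, zero_smul]

lemma IsTest.hasDerivAt_comp (hφ : IsTest q φ) (y : E d) (s : ℝ) :
    HasDerivAt (fun s : ℝ => φ (q (y + EuclideanSpace.single j s)))
      (fderiv ℝ (fun y => φ (q y)) (y + EuclideanSpace.single j s) (EuclideanSpace.single j 1))
      s := by
  have h2 : HasDerivAt (fun s : ℝ => y + (EuclideanSpace.single j s : E d))
      (EuclideanSpace.single j (1 : ℝ)) s := by
    rw [funext fun s => congrArg (y + ·) (single_eq_smul j s)]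
    simpa using ((hasDerivAt_id s).smul_const (EuclideanSpace.single j (1 : ℝ) : E d)).const_add y
  exact ((hφ.1.differentiable (by simp)).differentiableAt.hasFDerivAt).comp_hasDerivAt s h2

lemma IsTest.partialDeriv_comp (hq : IsDomainMap q) (hφ : IsTest q φ) (y : E d) :
    partialDeriv q j φ (q y) =
      fderiv ℝ (fun y => φ (q y)) y (EuclideanSpace.single j 1) := by
  have h := (hφ.hasDerivAt_comp (j := j) y 0).deriv
  simp_rw [hq.map_add] at h
  simpa [partialDeriv, single_zero] using h

lemma IsTest.hasDerivAt (hq : IsDomainMap q) (hφ : IsTest q φ) (x : X) (s : ℝ) :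
    HasDerivAt (fun s : ℝ => φ (x + q (EuclideanSpace.single j s)))
      (partialDeriv q j φ (x + q (EuclideanSpace.single j s))) s := by
  obtain ⟨y, rfl⟩ := hq.isOpenQuotientMap.surjective x
  simp_rw [← hq.map_add]
  rw [hφ.partialDeriv_comp hq]
  exact hφ.hasDerivAt_comp y s

lemma IsTest.continuous_partialDeriv (hq : IsDomainMap q) (hφ : IsTest q φ) :
    Continuous (partialDeriv q j φ) := by
  rw [← hq.isOpenQuotientMap.continuous_comp_iff]
  have : partialDeriv q j φ ∘ q =
      fun y => fderiv ℝ (fun y => φ (q y)) y (EuclideanSpace.single j 1) :=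
    funext fun y => hφ.partialDeriv_comp hq y
  rw [this]
  exact (hφ.1.continuous_fderiv (by simp)).clm_apply continuous_const

lemma continuous_single (j : Fin d) :
    Continuous fun s : ℝ => (EuclideanSpace.single j s : E d) := by
  rw [funext (single_eq_smul j)]
  fun_prop

lemma IsTest.hasCompactSupport_partialDeriv (hq : IsDomainMap q) (hφ : IsTest q φ) :
    HasCompactSupport (partialDeriv q j φ) := by
  refine hφ.2.mono' fun x hx => ?_
  by_contra h
  apply hx
  have hc : Continuous fun s : ℝ => x + q (EuclideanSpace.single j s) :=
    continuous_const.add (hq.continuous.comp (continuous_single j))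
  have h0 : ∀ᶠ s : ℝ in 𝓝 0, x + q (EuclideanSpace.single j s) ∈ (tsupport φ)ᶜ := by
    refine hc.continuousAt.eventually_mem ((isClosed_tsupport φ).isOpen_compl.mem_nhds ?_)
    simpa [hq.map_zero, single_zero] using h
  have h1 : (fun s : ℝ => φ (x + q (EuclideanSpace.single j s))) =ᶠ[𝓝 0] fun _ => (0 : ℝ) :=
    h0.mono fun s hs => image_eq_zero_of_notMem_tsupport hs
  rw [partialDeriv, h1.deriv_eq, deriv_const]

variable [Fact (1 ≤ p)]

lemma Lp_locallyIntegrable (h : Lp (E d) p (volume : Measure X)) :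
    LocallyIntegrable h (volume : Measure X) :=
  (Lp.memLp h).locallyIntegrable Fact.out

/-- Pairing with a continuous compactly supported function is bounded on `L^p`. -/
lemma exists_pairing (hφ : Continuous φ) (hφc : HasCompactSupport φ) :
    ∃ Λ : Lp (E d) p (volume : Measure X) →L[ℝ] E d, ∀ h, Λ h = ∫ x, φ x • h x := by
  have : Fact (1 ≤ ENNReal.conjExponent p) := ⟨by simp [ENNReal.conjExponent]⟩
  have : ENNReal.HolderConjugate p (ENNReal.conjExponent p) :=
    .conjExponent Fact.out
  have : ENNReal.HolderConjugate (ENNReal.conjExponent p) p := .symm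
  have hm : MemLp φ (ENNReal.conjExponent p) (volume : Measure X) :=
    hφ.memLp_of_hasCompactSupport hφc
  refine ⟨ContinuousLinearMap.lpPairing (volume : Measure X) (ENNReal.conjExponent p) p
    (ContinuousLinearMap.lsmul ℝ ℝ) (hm.toLp φ), fun h => ?_⟩
  rw [ContinuousLinearMap.lpPairing_eq_integral]
  refine integral_congr_ae ?_
  filter_upwards [hm.coeFn_toLp] with x hx
  simp [hx]

lemma integral_smul_translate (φ : X → ℝ) (a : X) (h : Lp (E d) p (volume : Measure X)) :
    ∫ x, φ x • translate a h x = ∫ x, φ (x + a) • h x := by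
  rw [← integral_sub_right_eq_self (fun x => φ (x + a) • h x) a]
  refine integral_congr_ae ?_
  filter_upwards [coeFn_translate a h] with x hx
  simp [hx]

lemma hasDerivAt_integral_smul (hq : IsDomainMap q) (hφ : IsTest q φ) {h : X → E d}
    (hh : LocallyIntegrable h (volume : Measure X)) (a : X) :
    HasDerivAt (fun s : ℝ => ∫ x, φ (x + (a + q (EuclideanSpace.single j s))) • h x)
      (∫ x, partialDeriv q j φ (x + a) • h x) 0 := by
  set D := partialDeriv q j φ with hD
  have hDc : Continuous D := hφ.continuous_partialDeriv hq
  have hDs : HasCompactSupport D := hφ.hasCompactSupport_partialDeriv hq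
  have hφc : Continuous φ := hφ.continuous hq
  have hr : Continuous fun s : ℝ => q (EuclideanSpace.single j s) :=
    hq.continuous.comp (continuous_single j)
  obtain ⟨C, hC⟩ := hDs.exists_bound_of_continuous hDc
  -- K contains the supports of all translates of D with |s| ≤ 1, so C‖h‖ on K dominates; it is
  -- integrable because h is locally integrable.
  set K : Set X := (fun x : X × ℝ => x.1 - (a + q (EuclideanSpace.single j x.2))) ''
    (tsupport D ×ˢ Set.Icc (-1) 1) with hK
  have hKc : IsCompact K :=
    (hDs.isCompact.prod isCompact_Icc).image
      (continuous_fst.sub (continuous_const.add (hr.comp continuous_snd)))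
  have hint : ∀ (ψ : X → ℝ), Continuous ψ → HasCompactSupport ψ → ∀ b : X,
      Integrable (fun x => ψ (x + b) • h x) (volume : Measure X) := fun ψ hψ hψc b =>
    hh.integrable_smul_left_of_hasCompactSupport (by fun_prop)
      (hψc.comp_homeomorph (Homeomorph.addRight b))
  have hq0 : q (EuclideanSpace.single j 0) = 0 := by simp [hq.map_zero, single_zero]
  have key := hasDerivAt_integral_of_dominated_loc_of_deriv_le (𝕜 := ℝ) (μ := (volume : Measure X))
    (F := fun s x => φ (x + (a + q (EuclideanSpace.single j s))) • h x)
    (F' := fun s x => D (x + (a + q (EuclideanSpace.single j s))) • h x)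
    (x₀ := (0 : ℝ)) (s := Set.Ioo (-1) 1) (bound := K.indicator fun x => C * ‖h x‖)
    (Ioo_mem_nhds (by norm_num) (by norm_num))
    (Eventually.of_forall fun s => (hint φ hφc hφ.2 _).aestronglyMeasurable)
    (hint φ hφc hφ.2 _) (hint D hDc hDs _).aestronglyMeasurable
    (Eventually.of_forall fun x s hs => ?_) ?_ (Eventually.of_forall fun x s hs => ?_)
  · simpa only [hq0, add_zero] using key.2
  · by_cases hx : x ∈ K
    · rw [Set.indicator_of_mem hx, norm_smul]
      gcongr
      exact hC _
    · rw [Set.indicator_of_notMem hx]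
      have : x + (a + q (EuclideanSpace.single j s)) ∉ tsupport D := fun h' =>
        hx ⟨(_, s), ⟨h', hs.1.le, hs.2.le⟩, by simp⟩
      rw [image_eq_zero_of_notMem_tsupport this, zero_smul, norm_zero]
  · rw [integrable_indicator_iff hKc.measurableSet]
    exact ((hh.integrableOn_isCompact hKc).norm).const_mul C
  · have := hφ.hasDerivAt (j := j) hq (x + a) s
    simp_rw [add_assoc] at this
    exact this.smul_const (h x)

/-- The operators `∂_j e^{ν t Δ}`, `t > 0`. -/
def heatGradL (hp : p ≠ ∞) (hq : Continuous q) (hν : 0 < ν) (j : Fin d) (t : ℝ) :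
    Lp (E d) p (volume : Measure X) →L[ℝ] Lp (E d) p (volume : Measure X) :=
  (√t)⁻¹ • average hp hq (integrable_heatKernelDeriv hν j) t

lemma isWeakPartial_iff (h g : Lp (E d) p (volume : Measure X)) :
    IsWeakPartial q j h g ↔
      ∀ φ : X → ℝ, IsTest q φ → ∫ x, φ x • g x = - ∫ x, partialDeriv q j φ x • h x :=
  ⟨fun H => H.2.2, fun H => ⟨Lp_locallyIntegrable h, Lp_locallyIntegrable g, H⟩⟩

lemma pairing_average (hp : p ≠ ∞) (hq : Continuous q) {k : E d → ℝ} (hk : Integrable k) (t : ℝ)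
    (Λ : Lp (E d) p (volume : Measure X) →L[ℝ] E d) (h : Lp (E d) p (volume : Measure X)) :
    Λ (average hp hq hk t h) = ∫ z, k z • Λ (translate (q (√t • z)) h) := by
  rw [average_apply, ← ContinuousLinearMap.integral_comp_comm _
    (integrable_smul_translate hp (by fun_prop) hk h)]
  simp_rw [map_smul]

/-- Tested against φ, the heat flow is a Gaussian average of z ↦ Λ(h translated by √t z). The
derivative of this function along the j-th axis is √t times the pairing with ∂ⱼφ. Integration by
parts in z moves it to the kernel, and √t cancels the factor in `heatGradL`. -/
lemma isWeakPartial_heatL (hp : p ≠ ∞) (hq : IsDomainMap q) (hν : 0 < ν) {t : ℝ} (ht : 0 < t)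
    (h : Lp (E d) p (volume : Measure X)) :
    IsWeakPartial q j (heatL hp hq.continuous hν t h) (heatGradL hp hq.continuous hν j t h) := by
  rw [isWeakPartial_iff]
  intro φ hφ
  obtain ⟨Λ, hΛ⟩ := exists_pairing (d := d) (p := p) (hφ.continuous hq) hφ.2
  obtain ⟨Λ', hΛ'⟩ := exists_pairing (d := d) (p := p) (hφ.continuous_partialDeriv (j := j) hq)
    (hφ.hasCompactSupport_partialDeriv hq)
  rw [← hΛ, ← hΛ', heatGradL, _root_.smul_apply, map_smul, heatL, pairing_average,
    pairing_average]
  have hI : ∀ (Λ : Lp (E d) p (volume : Measure X) →L[ℝ] E d) (k : E d → ℝ), Integrable k →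
      Integrable fun z => k z • Λ (translate (q (√t • z)) h) := fun Λ k hk => by
    have hc := hq.continuous
    have := Λ.integrable_comp (integrable_smul_translate hp
      (by fun_prop : Continuous fun z : E d => q (√t • z)) hk h)
    simpa [map_smul] using this
  have hk := integrable_heatKernel (d := d) hν one_pos
  have hk' := integrable_heatKernelDeriv hν j
  have hline : ∀ z : E d, HasLineDerivAt ℝ (fun z => Λ (translate (q (√t • z)) h))
      (√t • Λ' (translate (q (√t • z)) h)) z (EuclideanSpace.single j 1) := by
    intro z
    have h1 := hasDerivAt_integral_smul (j := j) hq hφ (Lp_locallyIntegrable h) (q (√t • z))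
    have h2 : HasDerivAt (fun s : ℝ => √t * s) (√t) 0 := by
      simpa using (hasDerivAt_id (0 : ℝ)).const_mul (√t)
    have h3 := HasDerivAt.scomp (x := (0 : ℝ)) (h := fun s : ℝ => √t * s)
      (g₁ := fun s : ℝ => ∫ x, φ (x + (q (√t • z) + q (EuclideanSpace.single j s))) • h x)
      (by simpa using h1) h2
    rw [hΛ', integral_smul_translate]
    unfold HasLineDerivAt
    convert! h3 using 1
    ext1 s
    simp only [Function.comp]
    rw [hΛ, integral_smul_translate, ← hq.map_add]
    have : √t • (z + s • EuclideanSpace.single j (1 : ℝ)) =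
        √t • z + EuclideanSpace.single j (√t * s) := by
      rw [smul_add, smul_smul, ← single_eq_smul]
    rw [this]
  have key := integral_bilinear_hasLineDerivAt_right_eq_neg_left_of_integrable
    (μ := (volume : Measure (E d))) (B := ContinuousLinearMap.lsmul ℝ ℝ)
    (f := heatKernel d ν 1) (f' := heatKernelDeriv d ν j)
    (g := fun z => Λ (translate (q (√t • z)) h))
    (g' := fun z => √t • Λ' (translate (q (√t • z)) h)) (v := EuclideanSpace.single j 1)
    (hI Λ _ hk') ?_ (hI Λ _ hk) (fun x _ => hasLineDerivAt_heatKernel hν j x) (fun x _ => hline x)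
  · simp only [ContinuousLinearMap.lsmul_apply] at key
    have hs : √t ≠ 0 := (Real.sqrt_pos.2 ht).ne'
    simp_rw [smul_comm _ (√t)] at key
    rw [integral_smul] at key
    rw [← neg_eq_iff_eq_neg.2 key, smul_neg, smul_smul, inv_mul_cancel₀ hs, one_smul]
  · simp only [ContinuousLinearMap.lsmul_apply, smul_comm _ (√t)]
    exact (hI Λ' _ hk).smul (√t)

end WeakDerivative

/-- Near t the family factors through the fixed bounded operator `A (t / 2)`, so strong continuity
is inherited from S although the norm of `A` may blow up at 0. -/
lemma continuousOn_of_semigroup {Y Z : Type*} [NormedAddCommGroup Y] [NormedSpace ℝ Y]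
    [NormedAddCommGroup Z] [NormedSpace ℝ Z] (A : ℝ → Y →L[ℝ] Z) (S : ℝ → Y →L[ℝ] Y)
    (hS : Continuous fun x : ℝ × Y => S x.1 x.2)
    (hAS : ∀ s t, 0 < s → s < t → t ≤ 1 → ∀ g, A t g = A s (S (t - s) g)) :
    ContinuousOn (fun x : ℝ × Y => A x.1 x.2) (Set.Ioc 0 1 ×ˢ Set.univ) := by
  rintro ⟨t, h⟩ ⟨⟨ht, ht1⟩, -⟩
  have hc : Continuous fun x : ℝ × Y => A (t / 2) (S (x.1 - t / 2) x.2) :=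
    (A (t / 2)).continuous.comp
      (hS.comp (by fun_prop : Continuous fun x : ℝ × Y => (x.1 - t / 2, x.2)))
  refine hc.continuousWithinAt.congr_of_eventuallyEq ?_
    (hAS _ t (half_pos ht) (half_lt_self ht) ht1 h)
  have hev : ∀ᶠ x : ℝ × Y in 𝓝 (t, h), t / 2 < x.1 :=
    continuous_fst.continuousAt.eventually_const_lt (half_lt_self ht)
  filter_upwards [mem_nhdsWithin_of_mem_nhds hev, self_mem_nhdsWithin] with x hx hx'
  exact hAS _ x.1 (half_pos ht) hx hx'.1.2 x.2

/-! ### Smoothing from L^p to L^∞. -/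

section Smoothing

variable {d : ℕ} {X : Type} [AddCommGroup X] [TopologicalSpace X] [IsTopologicalAddGroup X]
  [T2Space X] [SecondCountableTopology X] [LocallyCompactSpace X] [MeasureSpace X] [BorelSpace X]
  [IsLocallyFiniteMeasure (volume : Measure X)] [(volume : Measure X).IsAddRightInvariant]
  {p : ℝ≥0∞} {q : E d → X} {ν : ℝ}

lemma measurable_heatKernel (t : ℝ) : Measurable (heatKernel d ν t) :=
  (continuous_heatKernel t).measurable

/-- Allows the argument to be shifted by any z of a bounded cell, at the price of a wider Gaussian.
It rests on |y + z|² ≤ 2|y|² + 2R². -/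
lemma heatKernel_one_le (hν : 0 < ν) {R : ℝ} {y z : E d} (hz : ‖z‖ ≤ R) :
    heatKernel d ν 1 y ≤ (4 * Real.pi * ν * 1) ^ (-((d : ℝ) / 2)) *
      (Real.exp (R ^ 2 / (4 * ν)) * Real.exp (-(1 / (8 * ν)) * ‖y + z‖ ^ 2)) := by
  rw [heatKernel_eq, ← Real.exp_add]
  gcongr
  have h1 : ‖y + z‖ ^ 2 ≤ 2 * ‖y‖ ^ 2 + 2 * R ^ 2 := by
    have h2 : ‖y + z‖ ≤ ‖y‖ + R := (norm_add_le y z).trans (by gcongr)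
    have h3 : ‖y + z‖ ^ 2 ≤ (‖y‖ + R) ^ 2 := by gcongr
    nlinarith [sq_nonneg (‖y‖ - R)]
  have h4 : R ^ 2 / (4 * ν) + -(1 / (8 * ν)) * ‖y + z‖ ^ 2 - -(1 / (4 * ν * 1)) * ‖y‖ ^ 2 =
      (2 * ‖y‖ ^ 2 + 2 * R ^ 2 - ‖y + z‖ ^ 2) / (8 * ν) := by
    field_simp; ring
  have h5 : 0 ≤ (2 * ‖y‖ ^ 2 + 2 * R ^ 2 - ‖y + z‖ ^ 2) / (8 * ν) :=
    div_nonneg (by linarith) (by positivity)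
  linarith

/-- In effect, the kernel pushed forward to X is bounded. The integral is averaged over shifts z in
the cell B, and the kernel at y is replaced by the wider Gaussian at w = y + z. For fixed w the
integral over z is then at most ∫H, by the cell property and translation invariance. -/
lemma exists_lintegral_heatKernel_le (hq : IsDomainMap q) (hν : 0 < ν) :
    ∃ C : ℝ≥0∞, C ≠ ∞ ∧ ∀ H : X → ℝ≥0∞, Measurable H → ∀ x : X,
      ∫⁻ y, ENNReal.ofReal (heatKernel d ν 1 y) * H (x - q y) ≤ C * ∫⁻ x, H x := by
  obtain ⟨B, hBm, hBb, hB0, hB⟩ := hq.exists_cell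
  obtain ⟨R, hR⟩ := hBb.exists_norm_le
  set Γ : E d → ℝ := fun w => (4 * Real.pi * ν * 1) ^ (-((d : ℝ) / 2)) *
      (Real.exp (R ^ 2 / (4 * ν)) * Real.exp (-(1 / (8 * ν)) * ‖w‖ ^ 2)) with hΓ
  have hΓi : Integrable Γ :=
    ((integrable_exp_neg_mul_sq (by positivity)).const_mul _).const_mul _
  have hΓm : Measurable Γ := by fun_prop
  have hBtop : volume B ≠ ∞ := hBb.measure_lt_top.ne
  refine ⟨(volume B)⁻¹ * ∫⁻ w, ENNReal.ofReal (Γ w), ?_, fun H hH x => ?_⟩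
  · exact ENNReal.mul_ne_top (ENNReal.inv_ne_top.2 hB0) hΓi.lintegral_lt_top.ne
  have hqm : Measurable q := hq.continuous.measurable
  have key : volume B * ∫⁻ y, ENNReal.ofReal (heatKernel d ν 1 y) * H (x - q y) ≤
      (∫⁻ w, ENNReal.ofReal (Γ w)) * ∫⁻ x, H x := by
    calc volume B * ∫⁻ y, ENNReal.ofReal (heatKernel d ν 1 y) * H (x - q y)
        = ∫⁻ _ in B, ∫⁻ y, ENNReal.ofReal (heatKernel d ν 1 y) * H (x - q y) := by
          rw [lintegral_const, Measure.restrict_apply_univ, mul_comm]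
      _ ≤ ∫⁻ z in B, ∫⁻ y, ENNReal.ofReal (Γ (y + z)) * H (x - q y) := by
          refine setLIntegral_mono' hBm fun z hz => lintegral_mono fun y => ?_
          gcongr
          exact heatKernel_one_le hν (hR z hz)
      _ = ∫⁻ z in B, ∫⁻ w, ENNReal.ofReal (Γ w) * H (x - q w + q z) := by
          congr 1 with z
          rw [← lintegral_add_right_eq_self
            (fun w => ENNReal.ofReal (Γ w) * H (x - q w + q z)) z]
          congr 1 with y
          rw [hq.map_add]
          congr 2
          abel
      _ = ∫⁻ w, ∫⁻ z in B, ENNReal.ofReal (Γ w) * H (x - q w + q z) := by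
          rw [lintegral_lintegral_swap]
          exact Measurable.aemeasurable (by fun_prop)
      _ ≤ ∫⁻ w, ENNReal.ofReal (Γ w) * ∫⁻ x, H x := by
          refine lintegral_mono fun w => ?_
          rw [lintegral_const_mul _ (by fun_prop)]
          gcongr
          refine (hB (fun x' => H (x - q w + x')) (by fun_prop)).trans_eq ?_
          simp_rw [add_comm (x - q w)]
          exact lintegral_add_right_eq_self _ _
      _ = _ := lintegral_mul_const _ (by fun_prop)
  rw [mul_assoc]
  calc _ = (volume B)⁻¹ * (volume B *
        ∫⁻ y, ENNReal.ofReal (heatKernel d ν 1 y) * H (x - q y)) := by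
        rw [← mul_assoc, ENNReal.inv_mul_cancel hB0 hBtop, one_mul]
    _ ≤ _ := by gcongr

variable [Fact (1 ≤ p)]

/-- The kernel is a probability density, so the L¹ norm with respect to it is at most the L^p norm.
There the kernel is compared with the one at time 1, which is handled by
`exists_lintegral_heatKernel_le`. -/
lemma exists_lintegral_heatKernel_smul_le (hp : p ≠ ∞) (hq : IsDomainMap q) (hν : 0 < ν) :
    ∃ C : ℝ, 0 ≤ C ∧ ∀ (h : Lp (E d) p (volume : Measure X)) (t : ℝ), 0 < t → t ≤ 1 → ∀ x : X,
      ∫⁻ y, ‖heatKernel d ν t y • h (x - q y)‖ₑ ≤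
        ENNReal.ofReal (C * t ^ (-(d / (2 * p.toReal))) * ‖h‖) := by
  obtain ⟨C, hC, hCH⟩ := exists_lintegral_heatKernel_le hq hν
  have hp1 : (1 : ℝ≥0∞) ≤ p := Fact.out
  have hp0 : p ≠ 0 := (zero_lt_one.trans_le hp1).ne'
  have hpr : 0 < p.toReal := ENNReal.toReal_pos hp0 hp
  refine ⟨(C ^ (1 / p.toReal)).toReal, ENNReal.toReal_nonneg, fun h t ht ht1 x => ?_⟩
  set G : E d → ℝ≥0∞ := fun y => ENNReal.ofReal (heatKernel d ν t y) with hG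
  have hGm : Measurable G := (measurable_heatKernel t).ennreal_ofReal
  have hqm : Measurable q := hq.continuous.measurable
  have hhm : StronglyMeasurable h := Lp.stronglyMeasurable h
  have hFm : StronglyMeasurable fun y => h (x - q y) := hhm.comp_measurable (by fun_prop)
  have hprob : IsProbabilityMeasure ((volume : Measure (E d)).withDensity G) := by
    constructor
    rw [withDensity_apply _ MeasurableSet.univ, Measure.restrict_univ,
      ← ofReal_integral_eq_lintegral_ofReal (integrable_heatKernel hν ht)
        (Eventually.of_forall fun y => heatKernel_nonneg hν ht y), integral_heatKernel hν ht,
      ENNReal.ofReal_one]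
  have h1 : ∫⁻ y, ‖heatKernel d ν t y • h (x - q y)‖ₑ =
      eLpNorm (fun y => h (x - q y)) 1 ((volume : Measure (E d)).withDensity G) := by
    rw [eLpNorm_one_eq_lintegral_enorm, lintegral_withDensity_eq_lintegral_mul _ hGm hFm.enorm]
    congr 1 with y
    rw [enorm_smul, Pi.mul_apply, Real.enorm_of_nonneg (heatKernel_nonneg hν ht y)]
  have h2 : eLpNorm (fun y => h (x - q y)) p ((volume : Measure (E d)).withDensity G) ≤
      (ENNReal.ofReal (t ^ (-((d : ℝ) / 2))) * (C * ∫⁻ x, ‖h x‖ₑ ^ p.toReal)) ^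
        (1 / p.toReal) := by
    rw [eLpNorm_eq_lintegral_rpow_enorm_toReal hp0 hp,
      lintegral_withDensity_eq_lintegral_mul _ hGm (hFm.enorm.pow_const _)]
    gcongr
    calc ∫⁻ y, (G * fun y => ‖h (x - q y)‖ₑ ^ p.toReal) y
        ≤ ∫⁻ y, ENNReal.ofReal (t ^ (-((d : ℝ) / 2))) *
            (ENNReal.ofReal (heatKernel d ν 1 y) * ‖h (x - q y)‖ₑ ^ p.toReal) := by
          refine lintegral_mono fun y => ?_
          rw [Pi.mul_apply, ← mul_assoc, ← ENNReal.ofReal_mul (by positivity)]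
          gcongr
          exact ENNReal.ofReal_le_ofReal (heatKernel_le hν ht ht1 y)
      _ = ENNReal.ofReal (t ^ (-((d : ℝ) / 2))) *
            ∫⁻ y, ENNReal.ofReal (heatKernel d ν 1 y) * ‖h (x - q y)‖ₑ ^ p.toReal :=
          lintegral_const_mul _
            ((measurable_heatKernel 1).ennreal_ofReal.mul (hFm.enorm.pow_const _))
      _ ≤ _ := by
          gcongr
          exact hCH (fun x => ‖h x‖ₑ ^ p.toReal) (hhm.enorm.pow_const _) x
  rw [h1]
  refine (eLpNorm_le_eLpNorm_of_exponent_le hp1 hFm.aestronglyMeasurable).trans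
    (h2.trans_eq ?_)
  have h3 : (∫⁻ x, ‖h x‖ₑ ^ p.toReal) ^ (1 / p.toReal) = ENNReal.ofReal ‖h‖ := by
    rw [ofReal_norm, Lp.enorm_def, eLpNorm_eq_lintegral_rpow_enorm_toReal hp0 hp]
  have hpn : 0 ≤ 1 / p.toReal := by positivity
  rw [ENNReal.mul_rpow_of_nonneg _ _ hpn, ENNReal.mul_rpow_of_nonneg _ _ hpn, h3,
    ENNReal.ofReal_rpow_of_pos (by positivity), ← Real.rpow_mul ht.le,
    ENNReal.ofReal_mul (by positivity), ENNReal.ofReal_mul ENNReal.toReal_nonneg,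
    ENNReal.ofReal_toReal (ENNReal.rpow_ne_top_of_nonneg hpn hC),
    show -((d : ℝ) / 2) * (1 / p.toReal) = -(d / (2 * p.toReal)) by field_simp]
  ring

/-- `heatL` is a Bochner integral in L^p and carries no pointwise formula. Testing against φ and
Fubini identify it almost everywhere with the convolution `m`, to which the pointwise bound applies.
-/
lemma exists_norm_heatL_apply_le (hp : p ≠ ∞) (hq : IsDomainMap q) (hν : 0 < ν) :
    ∃ C : ℝ, 0 ≤ C ∧ ∀ (h : Lp (E d) p (volume : Measure X)) (t : ℝ), 0 < t → t ≤ 1 →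
      ∀ᵐ x, ‖heatL hp hq.continuous hν t h x‖ ≤ C * t ^ (-(d / (2 * p.toReal))) * ‖h‖ := by
  obtain ⟨C, hC0, hC⟩ := exists_lintegral_heatKernel_smul_le hp hq hν
  refine ⟨C, hC0, fun h t ht ht1 => ?_⟩
  set K : ℝ := C * t ^ (-(d / (2 * p.toReal))) * ‖h‖ with hK
  have hK0 : 0 ≤ K := by positivity
  set m : X → E d := fun x => ∫ y, heatKernel d ν t y • h (x - q y) with hm
  have hqm : Measurable q := hq.continuous.measurable
  have hhm : StronglyMeasurable h := Lp.stronglyMeasurable h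
  have hjoint : StronglyMeasurable fun x : X × E d => heatKernel d ν t x.2 • h (x.1 - q x.2) :=
    ((continuous_heatKernel t).stronglyMeasurable.comp_measurable measurable_snd).smul
      (hhm.comp_measurable (by fun_prop))
  have hmm : StronglyMeasurable m := hjoint.integral_prod_right
  have hmK : ∀ x, ‖m x‖ ≤ K := fun x => by
    refine (norm_integral_le_lintegral_norm _).trans ?_
    simp_rw [ofReal_norm]
    exact ENNReal.toReal_le_of_le_ofReal hK0 (hC h t ht ht1 x)
  have hml : LocallyIntegrable m (volume : Measure X) :=
    (locallyIntegrable_const K).mono hmm.aestronglyMeasurable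
      (Eventually.of_forall fun x => by simpa [abs_of_nonneg hK0] using hmK x)
  have hmain : (fun x => heatL hp hq.continuous hν t h x - m x) =ᵐ[volume] 0 := by
    refine hq.ae_eq_zero _ ((Lp_locallyIntegrable _).sub hml) fun φ hφ => ?_
    have hφc := hφ.continuous hq
    have hφi : Integrable φ (volume : Measure X) := hφc.integrable_of_hasCompactSupport hφ.2
    obtain ⟨Λ, hΛ⟩ := exists_pairing (d := d) (p := p) hφc hφ.2
    have hjφ : StronglyMeasurable fun x : X × E d =>
        φ x.1 • heatKernel d ν t x.2 • h (x.1 - q x.2) :=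
      (hφc.stronglyMeasurable.comp_measurable measurable_fst).smul hjoint
    have hint : Integrable (fun x : X × E d => φ x.1 • heatKernel d ν t x.2 • h (x.1 - q x.2))
        (volume.prod volume) := by
      refine ⟨hjφ.aestronglyMeasurable, ?_⟩
      rw [HasFiniteIntegral, lintegral_prod _ hjφ.enorm.aemeasurable]
      calc ∫⁻ x, ∫⁻ y, ‖φ x • heatKernel d ν t y • h (x - q y)‖ₑ
          ≤ ∫⁻ x, ‖φ x‖ₑ * ENNReal.ofReal K := by
            refine lintegral_mono fun x => ?_
            simp_rw [enorm_smul (φ x)]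
            rw [lintegral_const_mul']
            · gcongr
              exact hC h t ht ht1 x
            · exact enorm_ne_top
        _ = (∫⁻ x, ‖φ x‖ₑ) * ENNReal.ofReal K :=
            lintegral_mul_const _ hφc.measurable.enorm
        _ < ∞ := ENNReal.mul_lt_top hφi.2 ENNReal.ofReal_lt_top
    simp_rw [smul_sub]
    rw [integral_sub ((Lp_locallyIntegrable _).integrable_smul_left_of_hasCompactSupport hφc hφ.2)
      (hml.integrable_smul_left_of_hasCompactSupport hφc hφ.2), sub_eq_zero, ← hΛ,
      heatL_of_pos hp hq.continuous hν ht, ← ContinuousLinearMap.integral_comp_comm _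
        (integrable_smul_translate hp hq.continuous (integrable_heatKernel hν ht) h)]
    simp_rw [hm, ← integral_smul]
    rw [integral_integral_swap hint]
    congr 1 with y : 1
    rw [map_smul, hΛ, ← integral_smul]
    refine integral_congr_ae ?_
    filter_upwards [coeFn_translate (q y) h] with x hx
    rw [hx, smul_comm]
  filter_upwards [hmain] with x hx
  rw [sub_eq_zero.1 hx]
  exact hmK x

lemma exists_Linfty_lift
    (S : Lp (E d) p (volume : Measure X) →L[ℝ] Lp (E d) p (volume : Measure X)) {K : ℝ}
    (hK : 0 ≤ K) (hS : ∀ h, ∀ᵐ x, ‖S h x‖ ≤ K * ‖h‖) :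
    ∃ A : Lp (E d) p (volume : Measure X) →L[ℝ] Lp (E d) ∞ (volume : Measure X),
      ‖A‖ ≤ K ∧ ∀ h, A h =ᵐ[volume] S h := by
  have hm : ∀ h, MemLp (S h) ∞ (volume : Measure X) := fun h =>
    memLp_top_of_bound (Lp.aestronglyMeasurable _) _ (hS h)
  refine ⟨LinearMap.mkContinuous
    { toFun := fun h => (hm h).toLp
      map_add' := fun h g => ?_
      map_smul' := fun c h => ?_ } K fun h => ?_,
    LinearMap.mkContinuous_norm_le _ hK _, fun h => (hm h).coeFn_toLp⟩
  · rw [← MemLp.toLp_add]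
    refine (MemLp.toLp_eq_toLp_iff _ _).2 ?_
    rw [map_add]
    exact Lp.coeFn_add _ _
  · rw [RingHom.id_apply, ← MemLp.toLp_const_smul]
    refine (MemLp.toLp_eq_toLp_iff _ _).2 ?_
    rw [map_smul]
    exact Lp.coeFn_smul _ _
  · change ‖(hm h).toLp‖ ≤ _
    rw [Lp.norm_toLp, eLpNorm_exponent_top]
    exact ENNReal.toReal_le_of_le_ofReal (by positivity) (eLpNormEssSup_le_of_ae_bound (hS h))

/-- The smoothing effect of the heat semigroup: for `0 < t ≤ 1` it maps `L^p` to `L^∞`, with norm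
`O(t ^ (-d / 2p))`. -/
lemma exists_heat_Linfty (hp : p ≠ ∞) (hq : IsDomainMap q) (hν : 0 < ν) :
    ∃ (C : ℝ) (A : ℝ → Lp (E d) p (volume : Measure X) →L[ℝ] Lp (E d) ∞ (volume : Measure X)),
      0 ≤ C ∧
      (∀ t, 0 < t → t ≤ 1 → ‖A t‖ ≤ C * t ^ (-(d / (2 * p.toReal)))) ∧
      (∀ t, 0 < t → t ≤ 1 → ∀ h, A t h =ᵐ[volume] heatL hp hq.continuous hν t h) ∧
      ContinuousOn (fun x : ℝ × Lp (E d) p (volume : Measure X) => A x.1 x.2)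
        (Set.Ioc 0 1 ×ˢ Set.univ) := by
  obtain ⟨C, hC0, hC⟩ := exists_norm_heatL_apply_le (p := p) hp hq hν
  have hex : ∀ t, ∃ A : Lp (E d) p (volume : Measure X) →L[ℝ] Lp (E d) ∞ (volume : Measure X),
      0 < t → t ≤ 1 → ‖A‖ ≤ C * t ^ (-(d / (2 * p.toReal))) ∧
        ∀ h, A h =ᵐ[volume] heatL hp hq.continuous hν t h := by
    intro t
    by_cases ht : 0 < t ∧ t ≤ 1
    · have ht0 := ht.1
      obtain ⟨A, hA⟩ := exists_Linfty_lift (heatL hp hq.continuous hν t)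
        (K := C * t ^ (-(d / (2 * p.toReal)))) (by positivity) fun h => hC h t ht.1 ht.2
      exact ⟨A, fun _ _ => hA⟩
    · exact ⟨0, fun h h' => (ht ⟨h, h'⟩).elim⟩
  choose A hA using hex
  refine ⟨C, A, hC0, fun t ht ht1 => (hA t ht ht1).1, fun t ht ht1 => (hA t ht ht1).2, ?_⟩
  refine continuousOn_of_semigroup A (heatL hp hq.continuous hν)
    (continuous_heatL hp hq.continuous hν) fun s t hs hst ht g => ?_
  apply Lp.ext
  have h1 := (hA t (hs.trans hst) ht).2 g
  have h2 := (hA s hs (hst.le.trans ht)).2 (heatL hp hq.continuous hν (t - s) g)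
  rw [heatL_heatL hp hq.continuous hq.map_add hν hs.le (sub_nonneg.2 hst.le),
    add_sub_cancel] at h2
  filter_upwards [h1, h2] with x hx1 hx2
  rw [hx1, hx2]

end Smoothing

/-! ### Singular potentials in time. -/

/-- The singular kernel `r ↦ r ^ (-a)` on `r > 0`, extended by zero. -/
def singularKernel (a r : ℝ) : ℝ≥0∞ := if 0 < r then ENNReal.ofReal (r ^ (-a)) else 0

lemma measurable_singularKernel (a : ℝ) : Measurable (singularKernel a) := by
  unfold singularKernel
  refine Measurable.ite measurableSet_Ioi ?_ measurable_const
  fun_prop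

/-- The smaller of the two arguments may carry both exponents. If one argument is not positive, the
product vanishes. -/
lemma singularKernel_mul_le {a b : ℝ} (ha : 0 ≤ a) (hb : 0 ≤ b) (x y : ℝ) :
    singularKernel a x * singularKernel b y ≤
      singularKernel (a + b) x + singularKernel (a + b) y := by
  unfold singularKernel
  split_ifs with hx hy hy
  · rcases le_total x y with h | h
    · refine le_add_right ?_
      rw [← ENNReal.ofReal_mul (by positivity)]
      refine ENNReal.ofReal_le_ofReal ?_
      rw [neg_add, Real.rpow_add hx]
      exact mul_le_mul_of_nonneg_left (Real.rpow_le_rpow_of_nonpos hx h (neg_nonpos.2 hb))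
        (by positivity)
    · refine le_add_left ?_
      rw [← ENNReal.ofReal_mul (by positivity)]
      refine ENNReal.ofReal_le_ofReal ?_
      rw [neg_add, Real.rpow_add hy]
      exact mul_le_mul_of_nonneg_right (Real.rpow_le_rpow_of_nonpos hy h (neg_nonpos.2 ha))
        (by positivity)
  all_goals simp

lemma setLIntegral_singularKernel {c τ : ℝ} (hc : c < 1) (hτ : 0 ≤ τ) :
    ∫⁻ r in Set.Ioc 0 τ, singularKernel c r = ENNReal.ofReal (τ ^ (1 - c) / (1 - c)) := by
  have h1 : ∫⁻ r in Set.Ioc 0 τ, singularKernel c r =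
      ∫⁻ r in Set.Ioc 0 τ, ENNReal.ofReal (r ^ (-c)) :=
    setLIntegral_congr_fun measurableSet_Ioc fun r hr => by simp [singularKernel, hr.1]
  have hi : IntervalIntegrable (fun r : ℝ => r ^ (-c)) volume 0 τ :=
    intervalIntegral.intervalIntegrable_rpow' (by linarith)
  rw [h1, ← ofReal_integral_eq_lintegral_ofReal
    ((intervalIntegrable_iff_integrableOn_Ioc_of_le hτ).1 hi), ← intervalIntegral.integral_of_le hτ,
    integral_rpow (Or.inl (by linarith)), Real.zero_rpow (by linarith),
    show -c + 1 = 1 - c by ring, sub_zero]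
  filter_upwards [ae_restrict_mem measurableSet_Ioc] with r hr
  exact Real.rpow_nonneg hr.1.le _

lemma setLIntegral_singularKernel_sub_le {c τ s : ℝ} (hc : c < 1) (hτ : 0 ≤ τ) (hs : 0 ≤ s) :
    ∫⁻ t in Set.Ioc 0 τ, singularKernel c (t - s) ≤ ENNReal.ofReal (τ ^ (1 - c) / (1 - c)) := by
  rw [← setLIntegral_singularKernel hc hτ, ← lintegral_indicator measurableSet_Ioc,
    ← lintegral_indicator measurableSet_Ioc,
    ← lintegral_sub_right_eq_self ((Set.Ioc 0 τ).indicator (singularKernel c)) s]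
  refine lintegral_mono fun t => ?_
  by_cases ht : t ∈ Set.Ioc 0 τ
  · rw [Set.indicator_of_mem ht]
    by_cases hts : 0 < t - s
    · have : t - s ∈ Set.Ioc 0 τ := ⟨hts, by linarith [ht.2]⟩
      rw [Set.indicator_of_mem this]
    · simp [singularKernel, hts]
  · rw [Set.indicator_of_notMem ht]
    exact zero_le

section Potential

variable {μ₁ μ₂ : Measure ℝ} [IsFiniteMeasure μ₁] [IsFiniteMeasure μ₂]

lemma measurable_lintegral_singularKernel (a : ℝ) :
    Measurable fun t => ∫⁻ s, singularKernel a (t - s) ∂μ₁ := by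
  have := measurable_singularKernel a
  exact Measurable.lintegral_prod_right (by fun_prop)

lemma setLIntegral_lintegral_singularKernel_le {c τ : ℝ} (hc : c < 1) (hτ : 0 ≤ τ)
    (hμ : ∀ᵐ s ∂μ₁, 0 ≤ s) :
    ∫⁻ t in Set.Ioc 0 τ, ∫⁻ s, singularKernel c (t - s) ∂μ₁ ≤
      ENNReal.ofReal (τ ^ (1 - c) / (1 - c)) * μ₁ Set.univ := by
  have hm := measurable_singularKernel c
  rw [lintegral_lintegral_swap (by fun_prop)]
  calc _ ≤ ∫⁻ _, ENNReal.ofReal (τ ^ (1 - c) / (1 - c)) ∂μ₁ :=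
        lintegral_mono_ae (hμ.mono fun s hs => setLIntegral_singularKernel_sub_le hc hτ hs)
    _ = _ := lintegral_const _

/-- The product is a double integral over the two measures. Replacing the product of kernels by a
sum of kernels of order a + b makes each term depend on one variable, so the other measure
contributes only its mass; the two terms give the factor 2. -/
lemma setLIntegral_potential_mul_le {a b τ : ℝ} (ha : 0 ≤ a) (hb : 0 ≤ b) (hab : a + b < 1)
    (hτ : 0 ≤ τ) (hμ₁ : ∀ᵐ s ∂μ₁, 0 ≤ s) (hμ₂ : ∀ᵐ s ∂μ₂, 0 ≤ s) :
    ∫⁻ t in Set.Ioc 0 τ, (∫⁻ s, singularKernel a (t - s) ∂μ₁) *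
        (∫⁻ s, singularKernel b (t - s) ∂μ₂) ≤
      2 * ENNReal.ofReal (τ ^ (1 - (a + b)) / (1 - (a + b))) * (μ₁ Set.univ * μ₂ Set.univ) := by
  have hma := measurable_singularKernel a
  have hmb := measurable_singularKernel b
  have hmc := measurable_singularKernel (a + b)
  set κ := ENNReal.ofReal (τ ^ (1 - (a + b)) / (1 - (a + b))) with hκ
  have h1 : ∀ t, (∫⁻ s, singularKernel a (t - s) ∂μ₁) * (∫⁻ s, singularKernel b (t - s) ∂μ₂) ≤
      (∫⁻ s, singularKernel (a + b) (t - s) ∂μ₁) * μ₂ Set.univ +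
        μ₁ Set.univ * ∫⁻ s, singularKernel (a + b) (t - s) ∂μ₂ := fun t => by
    calc _ = ∫⁻ s, ∫⁻ r, singularKernel a (t - s) * singularKernel b (t - r) ∂μ₂ ∂μ₁ := by
          rw [← lintegral_mul_const _ (by fun_prop)]
          congr 1 with s
          rw [lintegral_const_mul _ (by fun_prop)]
      _ ≤ ∫⁻ s, ∫⁻ r, singularKernel (a + b) (t - s) + singularKernel (a + b) (t - r)
            ∂μ₂ ∂μ₁ := by
          gcongr with s r
          exact singularKernel_mul_le ha hb _ _
      _ = _ := by
          have h2 : ∀ s, ∫⁻ r, singularKernel (a + b) (t - s) + singularKernel (a + b) (t - r)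
              ∂μ₂ = singularKernel (a + b) (t - s) * μ₂ Set.univ +
                ∫⁻ r, singularKernel (a + b) (t - r) ∂μ₂ := fun s => by
            rw [lintegral_add_left measurable_const, lintegral_const]
          simp_rw [h2]
          rw [lintegral_add_left (by fun_prop), lintegral_const, lintegral_mul_const _ (by fun_prop),
            mul_comm (μ₁ Set.univ)]
  calc _ ≤ ∫⁻ t in Set.Ioc 0 τ, ((∫⁻ s, singularKernel (a + b) (t - s) ∂μ₁) * μ₂ Set.univ +
        μ₁ Set.univ * ∫⁻ s, singularKernel (a + b) (t - s) ∂μ₂) := lintegral_mono h1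
    _ = (∫⁻ t in Set.Ioc 0 τ, ∫⁻ s, singularKernel (a + b) (t - s) ∂μ₁) * μ₂ Set.univ +
        μ₁ Set.univ * ∫⁻ t in Set.Ioc 0 τ, ∫⁻ s, singularKernel (a + b) (t - s) ∂μ₂ := by
        rw [lintegral_add_left ((measurable_lintegral_singularKernel _).mul_const _),
          lintegral_mul_const _ (measurable_lintegral_singularKernel _),
          lintegral_const_mul _ (measurable_lintegral_singularKernel _)]
    _ ≤ (κ * μ₁ Set.univ) * μ₂ Set.univ + μ₁ Set.univ * (κ * μ₂ Set.univ) := by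
        gcongr
        · exact setLIntegral_lintegral_singularKernel_le hab hτ hμ₁
        · exact setLIntegral_lintegral_singularKernel_le hab hτ hμ₂
    _ = _ := by ring

end Potential

/-! ### Duhamel integrals of singular operator families. -/

section Duhamel

variable {Y Z W : Type*} [NormedAddCommGroup Y] [NormedSpace ℝ Y]
  [NormedAddCommGroup Z] [NormedSpace ℝ Z]
  [NormedAddCommGroup W] [NormedSpace ℝ W]

/-- A family of operators `R t`, `0 < t ≤ N`, strongly continuous, of norm at most `C t ^ (-a)`. -/
structure IsSmoothing (R : ℝ → Y →L[ℝ] Z) (N C a : ℝ) : Prop where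
  const_nonneg : 0 ≤ C
  exponent_nonneg : 0 ≤ a
  exponent_lt_one : a < 1
  norm_le : ∀ t, 0 < t → t ≤ N → ‖R t‖ ≤ C * t ^ (-a)
  continuousOn : ContinuousOn (fun x : ℝ × Y => R x.1 x.2) (Set.Ioc 0 N ×ˢ Set.univ)

/-- `R_t u + ∫_0^t R_{t-s} g(s) ds`. -/
def duhamel (R : ℝ → Y →L[ℝ] Z) (u : Y) (g : ℝ → Y) (t : ℝ) : Z :=
  R t u + ∫ s in (0 : ℝ)..t, R (t - s) (g s)

/-- The measure `‖u‖ δ_0 + ‖g(s)‖ ds` on `[0, τ]`. -/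
def dataMeasure (u : Y) (g : ℝ → Y) (τ : ℝ) : Measure ℝ :=
  ‖u‖ₑ • Measure.dirac 0 + (volume.restrict (Set.Ioc 0 τ)).withDensity fun s => ‖g s‖ₑ

variable {R : ℝ → Y →L[ℝ] Z} {N C a τ : ℝ} {u : Y} {g : ℝ → Y}

lemma dataMeasure_univ (u : Y) (g : ℝ → Y) (τ : ℝ) :
    dataMeasure u g τ Set.univ = ‖u‖ₑ + ∫⁻ s in Set.Ioc 0 τ, ‖g s‖ₑ := by
  simp [dataMeasure, withDensity_apply _ MeasurableSet.univ]

lemma dataMeasure_univ_eq_ofReal (hg : IntegrableOn g (Set.Ioc 0 τ)) :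
    dataMeasure u g τ Set.univ = ENNReal.ofReal (‖u‖ + ∫ s in Set.Ioc 0 τ, ‖g s‖) := by
  rw [dataMeasure_univ, ENNReal.ofReal_add (norm_nonneg _) (integral_nonneg fun _ => norm_nonneg _),
    ofReal_integral_norm_eq_lintegral_enorm hg, ofReal_norm]

lemma isFiniteMeasure_dataMeasure (hg : IntegrableOn g (Set.Ioc 0 τ)) :
    IsFiniteMeasure (dataMeasure u g τ) :=
  ⟨by rw [dataMeasure_univ_eq_ofReal hg]; exact ENNReal.ofReal_lt_top⟩

lemma ae_dataMeasure_nonneg : ∀ᵐ s ∂(dataMeasure u g τ), 0 ≤ s := by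
  unfold dataMeasure
  rw [ae_add_measure_iff]
  constructor
  · refine Measure.ae_smul_measure ?_ _
    rw [ae_dirac_eq]
    simp
  · refine (withDensity_absolutelyContinuous _ _).ae_le ?_
    filter_upwards [ae_restrict_mem measurableSet_Ioc] with s hs using hs.1.le

lemma lintegral_dataMeasure (hg : IntegrableOn g (Set.Ioc 0 τ)) {F : ℝ → ℝ≥0∞}
    (hF : Measurable F) :
    ∫⁻ s, F s ∂(dataMeasure u g τ) = ‖u‖ₑ * F 0 + ∫⁻ s in Set.Ioc 0 τ, ‖g s‖ₑ * F s := by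
  unfold dataMeasure
  rw [lintegral_add_measure, lintegral_smul_measure, lintegral_dirac,
    lintegral_withDensity_eq_lintegral_mul₀ hg.1.enorm hF.aemeasurable, smul_eq_mul]
  rfl

lemma IsSmoothing.enorm_apply_le (hR : IsSmoothing R N C a) {r : ℝ} (hr : 0 < r) (hrN : r ≤ N)
    (y : Y) : ‖R r y‖ₑ ≤ ENNReal.ofReal C * (‖y‖ₑ * singularKernel a r) := by
  rw [singularKernel, if_pos hr, ← ofReal_norm, ← ofReal_norm,
    ← ENNReal.ofReal_mul (norm_nonneg _), ← ENNReal.ofReal_mul hR.const_nonneg]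
  refine ENNReal.ofReal_le_ofReal (((R r).le_of_opNorm_le (hR.norm_le r hr hrN) y).trans_eq ?_)
  ring

/-- The Dirac mass in `dataMeasure` produces the term of the initial value, so initial value and
source are bounded by one potential. -/
lemma IsSmoothing.setLIntegral_enorm_le (hR : IsSmoothing R N C a) {t : ℝ} (ht : t ∈ Set.Ioc 0 τ)
    (hτ : τ ≤ N) (hg : IntegrableOn g (Set.Ioc 0 τ)) :
    ‖R t u‖ₑ + ∫⁻ s in Set.Ioc 0 t, ‖R (t - s) (g s)‖ₑ ≤
      ENNReal.ofReal C * ∫⁻ s, singularKernel a (t - s) ∂(dataMeasure u g τ) := by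
  have hm := measurable_singularKernel a
  rw [lintegral_dataMeasure hg (by fun_prop), sub_zero, mul_add]
  refine add_le_add (hR.enorm_apply_le ht.1 (ht.2.trans hτ) u) ?_
  -- The endpoint s = t is dropped, since nothing is known about `R 0`.
  rw [← restrict_Ioo_eq_restrict_Ioc, ← lintegral_const_mul' _ _ ENNReal.ofReal_ne_top]
  calc _ ≤ ∫⁻ s in Set.Ioo 0 t, ENNReal.ofReal C * (‖g s‖ₑ * singularKernel a (t - s)) :=
        setLIntegral_mono' measurableSet_Ioo fun s hs =>
          hR.enorm_apply_le (by linarith [hs.2]) (by linarith [hs.1, ht.2]) _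
    _ ≤ _ := lintegral_mono_set
        (Set.Ioo_subset_Ioc_self.trans (Set.Ioc_subset_Ioc_right ht.2))

lemma IsSmoothing.enorm_duhamel_le (hR : IsSmoothing R N C a) {t : ℝ} (ht : t ∈ Set.Ioc 0 τ)
    (hτ : τ ≤ N) (hg : IntegrableOn g (Set.Ioc 0 τ)) :
    ‖duhamel R u g t‖ₑ ≤
      ENNReal.ofReal C * ∫⁻ s, singularKernel a (t - s) ∂(dataMeasure u g τ) := by
  refine le_trans ?_ (hR.setLIntegral_enorm_le ht hτ hg)
  refine (enorm_add_le _ _).trans ?_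
  gcongr
  rw [intervalIntegral.integral_of_le ht.1.le]
  exact enorm_integral_le_lintegral_enorm _

/-- `R` is continuous only away from time 0. Clamping the time to [N/(n+1), N] gives globally
continuous families, and the functions converge pointwise as n → ∞. -/
lemma IsSmoothing.aestronglyMeasurable_prod (hR : IsSmoothing R N C a) (hτ : τ ≤ N)
    (hg : IntegrableOn g (Set.Ioc 0 τ)) :
    AEStronglyMeasurable (fun x : ℝ × ℝ => {x : ℝ × ℝ | x.2 < x.1}.indicator
        (fun x => R (x.1 - x.2) (g x.2)) x)
      ((volume.restrict (Set.Ioc 0 τ)).prod (volume.restrict (Set.Ioc 0 τ))) := by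
  rcases le_or_gt N 0 with hN | hN
  · simp [Set.Ioc_eq_empty_of_le (hτ.trans hN)]
  have hmeas : ∀ n : ℕ, AEStronglyMeasurable (fun x : ℝ × ℝ =>
      {x : ℝ × ℝ | x.2 + N / (n + 1) < x.1}.indicator
        (fun x => R (max (N / (n + 1)) (min (x.1 - x.2) N)) (g x.2)) x)
      ((volume.restrict (Set.Ioc 0 τ)).prod (volume.restrict (Set.Ioc 0 τ))) := fun n => by
    have hc : Continuous fun x : ℝ × Y => R (max (N / (n + 1)) (min x.1 N)) x.2 := by
      refine hR.continuousOn.comp_continuous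
        (f := fun x : ℝ × Y => (max (N / (n + 1)) (min x.1 N), x.2)) (by fun_prop) fun x => ?_
      refine ⟨⟨lt_max_of_lt_left (by positivity), max_le ?_ (min_le_right _ _)⟩, trivial⟩
      exact div_le_self hN.le (by simp)
    refine AEStronglyMeasurable.indicator ?_ (measurableSet_lt (by fun_prop) (by fun_prop))
    refine hc.comp_aestronglyMeasurable (f := fun x : ℝ × ℝ => (x.1 - x.2, g x.2)) ?_
    exact (by fun_prop : Measurable fun x : ℝ × ℝ => x.1 - x.2).aestronglyMeasurable.prodMk
      hg.1.comp_snd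
  refine aestronglyMeasurable_of_tendsto_ae atTop hmeas ?_
  rw [Measure.prod_restrict]
  filter_upwards [ae_restrict_mem (measurableSet_Ioc.prod measurableSet_Ioc)] with x hx
  refine tendsto_const_nhds.congr' ?_
  have hlim : Tendsto (fun n : ℕ => N / ((n : ℝ) + 1)) atTop (𝓝 0) := by
    simpa [div_eq_mul_inv] using (tendsto_one_div_add_atTop_nhds_zero_nat (𝕜 := ℝ)).const_mul N
  by_cases h : x.2 < x.1
  · filter_upwards [hlim.eventually_lt_const (sub_pos.2 h)] with n hn
    have h1 : x ∈ {x : ℝ × ℝ | x.2 + N / (n + 1) < x.1} := by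
      simp only [Set.mem_ofPred_eq]; linarith
    rw [Set.indicator_of_mem (show x ∈ {x : ℝ × ℝ | x.2 < x.1} from h),
      Set.indicator_of_mem h1, min_eq_left (by linarith [hx.1.2, hx.2.1]), max_eq_right hn.le]
  · refine Eventually.of_forall fun n => ?_
    have h1 : x ∉ {x : ℝ × ℝ | x.2 + N / (n + 1) < x.1} := by
      have : 0 < N / ((n : ℝ) + 1) := by positivity
      simp only [Set.mem_ofPred_eq]; linarith
    simp only [Set.indicator_of_notMem (show x ∉ {x : ℝ × ℝ | x.2 < x.1} from h),
      Set.indicator_of_notMem h1]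

lemma IsSmoothing.aestronglyMeasurable_duhamel (hR : IsSmoothing R N C a) (hτ : τ ≤ N)
    (hg : IntegrableOn g (Set.Ioc 0 τ)) :
    AEStronglyMeasurable (duhamel R u g) (volume.restrict (Set.Ioc 0 τ)) := by
  refine AEStronglyMeasurable.add ?_ ?_
  · refine ContinuousOn.aestronglyMeasurable ?_ measurableSet_Ioc
    exact hR.continuousOn.comp (f := fun t : ℝ => (t, u)) (by fun_prop)
      fun t ht => ⟨⟨ht.1, ht.2.trans hτ⟩, trivial⟩
  · refine (hR.aestronglyMeasurable_prod hτ hg).integral_prod_right'.congr ?_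
    filter_upwards [ae_restrict_mem measurableSet_Ioc] with t ht
    rw [intervalIntegral.integral_of_le ht.1.le,
      ← restrict_Ioo_eq_restrict_Ioc (a := 0) (b := t)]
    have h1 : (fun s => {x : ℝ × ℝ | x.2 < x.1}.indicator
        (fun x => R (x.1 - x.2) (g x.2)) (t, s)) =
        (Set.Iio t).indicator fun s => R (t - s) (g s) := rfl
    rw [h1, integral_indicator measurableSet_Iio, Measure.restrict_restrict measurableSet_Iio]
    congr 2
    ext s
    simp only [Set.mem_inter_iff, Set.mem_Iio, Set.mem_Ioc, Set.mem_Ioo]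
    exact ⟨fun h => ⟨h.2.1, h.1⟩, fun h => ⟨h.2, h.1, h.2.le.trans ht.2⟩⟩

/-- The potential of g has finite integral over (0, τ], hence is finite for almost every t. For g
merely integrable in time, exceptional t cannot be excluded. -/
lemma IsSmoothing.ae_intervalIntegrable (hR : IsSmoothing R N C a) (hτ : τ ≤ N)
    (hg : IntegrableOn g (Set.Ioc 0 τ)) :
    ∀ᵐ t ∂(volume.restrict (Set.Ioc 0 τ)),
      IntervalIntegrable (fun s => R (t - s) (g s)) volume 0 t := by
  rcases le_or_gt τ 0 with h0 | h0
  · simp [Set.Ioc_eq_empty_of_le h0]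
  have := isFiniteMeasure_dataMeasure (u := 0) hg
  have hfin : ∀ᵐ t ∂(volume.restrict (Set.Ioc 0 τ)),
      ∫⁻ s, singularKernel a (t - s) ∂(dataMeasure 0 g τ) < ∞ :=
    ae_lt_top (measurable_lintegral_singularKernel a)
      ((setLIntegral_lintegral_singularKernel_le hR.exponent_lt_one h0.le
        ae_dataMeasure_nonneg).trans_lt
          (ENNReal.mul_lt_top ENNReal.ofReal_lt_top (measure_lt_top _ _))).ne
  filter_upwards [hfin, ae_restrict_mem measurableSet_Ioc,
    (hR.aestronglyMeasurable_prod hτ hg).prodMk_left] with t ht htm htmeas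
  rw [intervalIntegrable_iff_integrableOn_Ioc_of_le htm.1.le]
  refine ⟨?_, ?_⟩
  · rw [← restrict_Ioo_eq_restrict_Ioc]
    refine (htmeas.mono_measure (Measure.restrict_mono_set _ fun s (hs : s ∈ Set.Ioo 0 t) =>
      ⟨hs.1, hs.2.le.trans htm.2⟩)).congr ?_
    filter_upwards [ae_restrict_mem measurableSet_Ioo] with s hs
    exact Set.indicator_of_mem (show (t, s) ∈ {x : ℝ × ℝ | x.2 < x.1} from hs.2) _
  · exact (le_add_self.trans (hR.setLIntegral_enorm_le htm hτ hg)).trans_lt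
      (ENNReal.mul_lt_top ENNReal.ofReal_lt_top ht)

end Duhamel

/-! ### The bilinear estimate and local solvability. -/

section Bilinear

variable {Y Z W : Type*} [NormedAddCommGroup Y] [NormedSpace ℝ Y]
  [NormedAddCommGroup Z] [NormedSpace ℝ Z] [NormedAddCommGroup W] [NormedSpace ℝ W]
  {A : ℝ → Y →L[ℝ] Z} {K : ℝ → Y →L[ℝ] W} {N C C' a b τ : ℝ} {u u₁ u₂ : Y} {g g₁ g₂ : ℝ → Y}

lemma IsSmoothing.duhamel_sub {R : ℝ → Y →L[ℝ] Z} (hR : IsSmoothing R N C a) (hτ : τ ≤ N)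
    (hg₁ : IntegrableOn g₁ (Set.Ioc 0 τ)) (hg₂ : IntegrableOn g₂ (Set.Ioc 0 τ)) :
    ∀ᵐ t ∂(volume.restrict (Set.Ioc 0 τ)),
      duhamel R u g₁ t - duhamel R u g₂ t = duhamel R 0 (fun s => g₁ s - g₂ s) t := by
  filter_upwards [hR.ae_intervalIntegrable hτ hg₁, hR.ae_intervalIntegrable hτ hg₂] with t h1 h2
  simp only [duhamel, map_zero, zero_add, map_sub]
  rw [intervalIntegral.integral_sub h1 h2]
  abel

/-- The bilinear estimate: if `A` and `K` are smoothing of orders `a` and `b` with `a + b < 1`, then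
a bounded bilinear map of the two Duhamel integrals is integrable in time. -/
lemma bilinear_duhamel (hA : IsSmoothing A N C a) (hK : IsSmoothing K N C' b) (hab : a + b < 1)
    (B : Z →L[ℝ] W →L[ℝ] Y) (h0 : 0 ≤ τ) (hτ : τ ≤ N)
    (hg₁ : IntegrableOn g₁ (Set.Ioc 0 τ)) (hg₂ : IntegrableOn g₂ (Set.Ioc 0 τ)) :
    IntegrableOn (fun t => B (duhamel A u₁ g₁ t) (duhamel K u₂ g₂ t)) (Set.Ioc 0 τ) ∧
    ∫ t in Set.Ioc 0 τ, ‖B (duhamel A u₁ g₁ t) (duhamel K u₂ g₂ t)‖ ≤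
      ‖B‖ * C * C' * (2 * (τ ^ (1 - (a + b)) / (1 - (a + b)))) *
        ((‖u₁‖ + ∫ s in Set.Ioc 0 τ, ‖g₁ s‖) * (‖u₂‖ + ∫ s in Set.Ioc 0 τ, ‖g₂ s‖)) := by
  have hf1 := isFiniteMeasure_dataMeasure (u := u₁) hg₁
  have hf2 := isFiniteMeasure_dataMeasure (u := u₂) hg₂
  have hC := hA.const_nonneg
  have hC' := hK.const_nonneg
  have hκ : 0 ≤ τ ^ (1 - (a + b)) / (1 - (a + b)) :=
    div_nonneg (Real.rpow_nonneg h0 _) (by linarith)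
  have hm1 : 0 ≤ ‖u₁‖ + ∫ s in Set.Ioc 0 τ, ‖g₁ s‖ :=
    add_nonneg (norm_nonneg _) (integral_nonneg fun _ => norm_nonneg _)
  have hm2 : 0 ≤ ‖u₂‖ + ∫ s in Set.Ioc 0 τ, ‖g₂ s‖ :=
    add_nonneg (norm_nonneg _) (integral_nonneg fun _ => norm_nonneg _)
  have hmeas : AEStronglyMeasurable (fun t => B (duhamel A u₁ g₁ t) (duhamel K u₂ g₂ t))
      (volume.restrict (Set.Ioc 0 τ)) :=
    B.aestronglyMeasurable_comp₂ (hA.aestronglyMeasurable_duhamel hτ hg₁)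
      (hK.aestronglyMeasurable_duhamel hτ hg₂)
  have hbound : ∫⁻ t in Set.Ioc 0 τ, ‖B (duhamel A u₁ g₁ t) (duhamel K u₂ g₂ t)‖ₑ ≤
      ENNReal.ofReal (‖B‖ * C * C' * (2 * (τ ^ (1 - (a + b)) / (1 - (a + b)))) *
        ((‖u₁‖ + ∫ s in Set.Ioc 0 τ, ‖g₁ s‖) * (‖u₂‖ + ∫ s in Set.Ioc 0 τ, ‖g₂ s‖))) := by
    set D := ‖B‖ * C * C' with hD
    have hD0 : 0 ≤ D := by positivity
    calc _ ≤ ∫⁻ t in Set.Ioc 0 τ, ENNReal.ofReal D *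
          ((∫⁻ s, singularKernel a (t - s) ∂(dataMeasure u₁ g₁ τ)) *
            ∫⁻ s, singularKernel b (t - s) ∂(dataMeasure u₂ g₂ τ)) := by
          refine setLIntegral_mono' measurableSet_Ioc fun t ht => ?_
          calc _ ≤ ‖B‖ₑ * ‖duhamel A u₁ g₁ t‖ₑ * ‖duhamel K u₂ g₂ t‖ₑ :=
                (ContinuousLinearMap.le_opENorm _ _).trans
                  (by gcongr; exact ContinuousLinearMap.le_opENorm _ _)
            _ ≤ ‖B‖ₑ * (ENNReal.ofReal C * _) * (ENNReal.ofReal C' * _) := by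
                gcongr
                · exact hA.enorm_duhamel_le ht hτ hg₁
                · exact hK.enorm_duhamel_le ht hτ hg₂
            _ = _ := by
                rw [hD, ENNReal.ofReal_mul (by positivity), ENNReal.ofReal_mul (by positivity),
                  show ‖B‖ₑ = ENNReal.ofReal ‖B‖ from (ofReal_norm B).symm]
                ring
      _ ≤ ENNReal.ofReal D * (2 * ENNReal.ofReal (τ ^ (1 - (a + b)) / (1 - (a + b))) *
            (dataMeasure u₁ g₁ τ Set.univ * dataMeasure u₂ g₂ τ Set.univ)) := by
          rw [lintegral_const_mul' _ _ ENNReal.ofReal_ne_top]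
          gcongr
          exact setLIntegral_potential_mul_le hA.exponent_nonneg hK.exponent_nonneg hab h0
            ae_dataMeasure_nonneg ae_dataMeasure_nonneg
      _ = _ := by
          rw [dataMeasure_univ_eq_ofReal hg₁, dataMeasure_univ_eq_ofReal hg₂,
            ← ENNReal.ofReal_mul hm1, show (2 : ℝ≥0∞) = ENNReal.ofReal 2 by simp,
            ← ENNReal.ofReal_mul (by norm_num), ← ENNReal.ofReal_mul (by positivity),
            ← ENNReal.ofReal_mul hD0]
          congr 1
          ring
  refine ⟨⟨hmeas, hbound.trans_lt ENNReal.ofReal_lt_top⟩, ?_⟩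
  rw [integral_norm_eq_lintegral_enorm hmeas]
  exact ENNReal.toReal_le_of_le_ofReal (by positivity) hbound

lemma exists_rpow_mul_le {c M ε : ℝ} (hc : 0 < c) (hM : 0 ≤ M) (hε : 0 < ε) {T : ℝ} (hT : 0 < T) :
    ∃ σ, 0 < σ ∧ σ ≤ T ∧ ∀ τ, 0 ≤ τ → τ ≤ σ → M * τ ^ c ≤ ε := by
  have h1 : Tendsto (fun τ : ℝ => M * τ ^ c) (𝓝 0) (𝓝 0) := by
    have := ((Real.continuousAt_rpow_const 0 c (Or.inr hc.le)).tendsto).const_mul M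
    simpa [Real.zero_rpow hc.ne'] using this
  have h2 : ∀ᶠ τ in 𝓝[>] (0 : ℝ), M * τ ^ c < ε :=
    (h1.eventually_lt_const hε).filter_mono nhdsWithin_le_nhds
  obtain ⟨σ, hσ, hσ0, hσT⟩ := (h2.and (Ioc_mem_nhdsGT hT)).exists
  refine ⟨σ, hσ0, hσT, fun τ h0 hτ => le_trans ?_ hσ.le⟩
  gcongr

variable [CompleteSpace Y]

/-- Local solvability of `ω = B(v, Dv)`, where `v` and `Dv` are the Duhamel integrals of `f - ω`. -/
lemma exists_duhamel_fixedPoint (hA : IsSmoothing A N C a) (hK : IsSmoothing K N C' b)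
    (hab : a + b < 1) (B : Z →L[ℝ] W →L[ℝ] Y) {σ₀ : ℝ} (hσ₀ : 0 < σ₀) (hσN : σ₀ ≤ N) (u : Y)
    {f : ℝ → Y} (hf : IntegrableOn f (Set.Ioc 0 σ₀)) :
    ∃ σ, 0 < σ ∧ σ ≤ σ₀ ∧ ∃ ω : ℝ → Y, IntegrableOn ω (Set.Ioc 0 σ) ∧
      ∀ᵐ t ∂(volume.restrict (Set.Ioc 0 σ)), ω t =
        B (duhamel A u (fun s => f s - ω s) t) (duhamel K u (fun s => f s - ω s) t) := by
  have hC := hA.const_nonneg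
  have hC' := hK.const_nonneg
  have hc : 0 < 1 - (a + b) := by linarith
  set M : ℝ := ‖u‖ + ∫ s in Set.Ioc 0 σ₀, ‖f s‖ with hM
  have hM0 : 0 ≤ M := add_nonneg (norm_nonneg _) (integral_nonneg fun _ => norm_nonneg _)
  set D : ℝ := ‖B‖ * C * C' * (2 / (1 - (a + b))) with hD
  have hD0 : 0 ≤ D := by positivity
  -- M + 1 bounds the mass of the data f - ω for ω in the unit ball of L¹. The bound 1/4 makes the
  -- ball invariant and, the difference having two bilinear terms, gives contraction factor 1/2.
  obtain ⟨σ, hσ, hσσ₀, hsmall⟩ := exists_rpow_mul_le hc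
    (by positivity : 0 ≤ D * (M + 1) * (M + 1)) (by norm_num : (0 : ℝ) < 1 / 4) hσ₀
  refine ⟨σ, hσ, hσσ₀, ?_⟩
  set κ : ℝ := ‖B‖ * C * C' * (2 * (σ ^ (1 - (a + b)) / (1 - (a + b)))) with hκ
  have hκ0 : 0 ≤ κ := by positivity
  have hκ1 : κ * ((M + 1) * (M + 1)) ≤ 1 / 4 := by
    refine le_trans (le_of_eq ?_) (hsmall σ hσ.le le_rfl)
    rw [hκ, hD]; ring
  have hκ2 : κ * (M + 1) ≤ 1 / 4 := by
    refine le_trans ?_ hκ1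
    gcongr
    nlinarith
  set μ : Measure ℝ := volume.restrict (Set.Ioc 0 σ) with hμ
  have hfσ : IntegrableOn f (Set.Ioc 0 σ) := hf.mono_set (Set.Ioc_subset_Ioc_right hσσ₀)
  have hfM : ‖u‖ + ∫ s, ‖f s‖ ∂μ ≤ M := by
    have := setIntegral_mono_set hf.norm (Eventually.of_forall fun _ => norm_nonneg _)
      (LE.le.eventuallyLE (Set.Ioc_subset_Ioc_right hσσ₀))
    linarith
  have hσN' : σ ≤ N := hσσ₀.trans hσN
  have hωi : ∀ ω : Lp Y 1 μ, Integrable ω μ := L1.integrable_coeFn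
  have hgi : ∀ ω : Lp Y 1 μ, IntegrableOn (fun s => f s - ω s) (Set.Ioc 0 σ) := fun ω =>
    hfσ.sub (hωi ω)
  have hgn : ∀ ω : Lp Y 1 μ, ‖ω‖ ≤ 1 → ‖u‖ + ∫ s in Set.Ioc 0 σ, ‖f s - ω s‖ ≤ M + 1 :=
    fun ω hω => by
    have h1 : ∫ s, ‖f s - ω s‖ ∂μ ≤ ∫ s, ‖f s‖ + ‖ω s‖ ∂μ :=
      integral_mono (hgi ω).norm (hfσ.norm.add (hωi ω).norm) fun s => norm_sub_le _ _
    rw [integral_add hfσ.norm (hωi ω).norm, ← L1.norm_eq_integral_norm] at h1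
    linarith
  set Φ : Lp Y 1 μ → ℝ → Y := fun ω t =>
    B (duhamel A u (fun s => f s - ω s) t) (duhamel K u (fun s => f s - ω s) t) with hΦ
  have hΦb := fun ω : Lp Y 1 μ => bilinear_duhamel (u₁ := u) (u₂ := u) hA hK hab B hσ.le hσN'
    (hgi ω) (hgi ω)
  have hΦi : ∀ ω, Integrable (Φ ω) μ := fun ω => (hΦb ω).1
  set Ψ : Lp Y 1 μ → Lp Y 1 μ := fun ω => (hΦi ω).toL1 (Φ ω) with hΨ
  have hΨn : ∀ ω, ‖Ψ ω‖ = ∫ t, ‖Φ ω t‖ ∂μ := fun ω => L1.norm_of_fun_eq_integral_norm (hΦi ω)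
  have hΨs : ∀ ω₁ ω₂, ‖Ψ ω₁ - Ψ ω₂‖ = ∫ t, ‖(Φ ω₁ - Φ ω₂) t‖ ∂μ := fun ω₁ ω₂ => by
    have h1 : Ψ ω₁ - Ψ ω₂ = ((hΦi ω₁).sub (hΦi ω₂)).toL1 (Φ ω₁ - Φ ω₂) :=
      (Integrable.toL1_sub _ _ (hΦi ω₁) (hΦi ω₂)).symm
    rw [h1]
    exact L1.norm_of_fun_eq_integral_norm _
  have hΨmaps : Set.MapsTo Ψ (Metric.closedBall 0 1) (Metric.closedBall 0 1) := fun ω hω => by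
    rw [mem_closedBall_zero_iff] at hω ⊢
    rw [hΨn]
    refine (hΦb ω).2.trans ?_
    have := hgn ω hω
    have h0 : 0 ≤ ‖u‖ + ∫ s in Set.Ioc 0 σ, ‖f s - ω s‖ :=
      add_nonneg (norm_nonneg _) (integral_nonneg fun _ => norm_nonneg _)
    calc _ ≤ κ * ((M + 1) * (M + 1)) := by gcongr
      _ ≤ 1 := hκ1.trans (by norm_num)
  have hlip : ∀ ω₁ ∈ Metric.closedBall (0 : Lp Y 1 μ) 1, ∀ ω₂ ∈ Metric.closedBall (0 : Lp Y 1 μ) 1,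
      ‖Ψ ω₁ - Ψ ω₂‖ ≤ 1 / 2 * ‖ω₁ - ω₂‖ := fun ω₁ h1 ω₂ h2 => by
    rw [mem_closedBall_zero_iff] at h1 h2
    have hdi : IntegrableOn (fun s => (f s - ω₁ s) - (f s - ω₂ s)) (Set.Ioc 0 σ) :=
      (hgi ω₁).sub (hgi ω₂)
    have hdn : ‖(0 : Y)‖ + ∫ s in Set.Ioc 0 σ, ‖(f s - ω₁ s) - (f s - ω₂ s)‖ = ‖ω₁ - ω₂‖ := by
      rw [norm_zero, zero_add, L1.norm_eq_integral_norm]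
      refine integral_congr_ae ?_
      filter_upwards [Lp.coeFn_sub ω₁ ω₂] with s hs
      rw [hs, Pi.sub_apply, sub_sub_sub_cancel_left, norm_sub_rev]
    have hb1 := bilinear_duhamel (u₁ := 0) (u₂ := u) hA hK hab B hσ.le hσN' hdi (hgi ω₁)
    have hb2 := bilinear_duhamel (u₁ := u) (u₂ := 0) hA hK hab B hσ.le hσN' (hgi ω₂) hdi
    rw [hdn] at hb1 hb2
    rw [hΨs]
    -- B(v₁, Dv₁) - B(v₂, Dv₂) = B(v₁ - v₂, Dv₁) + B(v₂, Dv₁ - Dv₂), where the differences are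
    -- Duhamel integrals with zero initial value.
    have hae : ∀ᵐ t ∂μ, ‖(Φ ω₁ - Φ ω₂) t‖ ≤
        ‖B (duhamel A 0 (fun s => (f s - ω₁ s) - (f s - ω₂ s)) t)
            (duhamel K u (fun s => f s - ω₁ s) t)‖ +
          ‖B (duhamel A u (fun s => f s - ω₂ s) t)
            (duhamel K 0 (fun s => (f s - ω₁ s) - (f s - ω₂ s)) t)‖ := by
      filter_upwards [hA.duhamel_sub (u := u) hσN' (hgi ω₁) (hgi ω₂),
        hK.duhamel_sub (u := u) hσN' (hgi ω₁) (hgi ω₂)] with t hA' hK'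
      rw [← hA', ← hK']
      refine le_trans (le_of_eq ?_) (norm_add_le _ _)
      simp only [hΦ, Pi.sub_apply, map_sub, _root_.sub_apply]
      congr 1
      abel
    have hn1 := hgn ω₁ h1
    have hn2 := hgn ω₂ h2
    calc _ ≤ ∫ t, (_ + _) ∂μ :=
          integral_mono_ae ((hΦi ω₁).sub (hΦi ω₂)).norm (hb1.1.norm.add hb2.1.norm) hae
      _ = (∫ t, _ ∂μ) + ∫ t, _ ∂μ := integral_add hb1.1.norm hb2.1.norm
      _ ≤ κ * (‖ω₁ - ω₂‖ * (M + 1)) + κ * ((M + 1) * ‖ω₁ - ω₂‖) := by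
          refine add_le_add (hb1.2.trans ?_) (hb2.2.trans ?_) <;> gcongr
      _ = (κ * (M + 1)) * (2 * ‖ω₁ - ω₂‖) := by ring
      _ ≤ 1 / 4 * (2 * ‖ω₁ - ω₂‖) := by gcongr
      _ = _ := by ring
  have hcontr : ContractingWith (1 / 2) (hΨmaps.restrict Ψ _ _) := by
    refine ⟨by norm_num, LipschitzWith.of_dist_le_mul fun x y => ?_⟩
    have := hlip x x.2 y y.2
    rw [← dist_eq_norm, ← dist_eq_norm] at this
    simpa [Subtype.dist_eq] using this
  obtain ⟨ω, -, hfix, -⟩ := hcontr.exists_fixedPoint' Metric.isClosed_closedBall.isComplete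
    hΨmaps (Metric.mem_closedBall_self zero_le_one) (edist_ne_top _ _)
  refine ⟨ω, hωi ω, ?_⟩
  have h1 := (hΦi ω).coeFn_toL1
  have h2 : (hΦi ω).toL1 (Φ ω) = ω := hfix
  rw [h2] at h1
  exact h1

end Bilinear

/-- A relation between two families of operators passes to their Duhamel integrals. -/
lemma map_duhamel_eq {Y Z Z' F : Type*} [NormedAddCommGroup Y] [NormedSpace ℝ Y]
    [NormedAddCommGroup Z] [NormedSpace ℝ Z] [NormedAddCommGroup Z'] [NormedSpace ℝ Z']
    [NormedAddCommGroup F] [NormedSpace ℝ F] [CompleteSpace F] [CompleteSpace Z] [CompleteSpace Z']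
    {R : ℝ → Y →L[ℝ] Z} {R' : ℝ → Y →L[ℝ] Z'} (Λ : Z →L[ℝ] F) (Λ' : Z' →L[ℝ] F) {t : ℝ}
    (ht : 0 < t) (h : ∀ s, 0 < s → s ≤ t → ∀ y, Λ (R s y) = Λ' (R' s y)) {g : ℝ → Y}
    (hi : IntervalIntegrable (fun s => R (t - s) (g s)) volume 0 t)
    (hi' : IntervalIntegrable (fun s => R' (t - s) (g s)) volume 0 t) (u : Y) :
    Λ (duhamel R u g t) = Λ' (duhamel R' u g t) := by
  unfold duhamel
  rw [map_add, map_add, h t ht le_rfl, ← Λ.intervalIntegral_comp_comm hi,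
    ← Λ'.intervalIntegral_comp_comm hi', intervalIntegral.integral_of_le ht.le,
    intervalIntegral.integral_of_le ht.le, integral_Ioc_eq_integral_Ioo,
    integral_Ioc_eq_integral_Ioo]
  congr 1
  exact setIntegral_congr_fun measurableSet_Ioo fun s hs =>
    h _ (by linarith [hs.2]) (by linarith [hs.1]) _

/-! ### The advection term along the heat flow. -/

section Advection

variable {d : ℕ} {X : Type} [AddCommGroup X] [TopologicalSpace X] [IsTopologicalAddGroup X]
  [T2Space X] [SecondCountableTopology X] [LocallyCompactSpace X] [MeasureSpace X] [BorelSpace X]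
  [IsLocallyFiniteMeasure (volume : Measure X)] [(volume : Measure X).IsAddRightInvariant]
  {p : ℝ≥0∞} {q : E d → X} {ν : ℝ} {N τ : ℝ}

lemma IsWeakPartial.unique (hq : IsDomainMap q) {j : Fin d} {h g g' : X → E d}
    (hg : IsWeakPartial q j h g) (hg' : IsWeakPartial q j h g') : g =ᵐ[volume] g' := by
  have h0 := hq.ae_eq_zero (fun x => g x - g' x) (hg.2.1.sub hg'.2.1) fun φ hφ => by
    have hφc := hφ.continuous hq
    simp_rw [smul_sub]
    rw [integral_sub (hg.2.1.integrable_smul_left_of_hasCompactSupport hφc hφ.2)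
      (hg'.2.1.integrable_smul_left_of_hasCompactSupport hφc hφ.2), hg.2.2 φ hφ, hg'.2.2 φ hφ,
      sub_self]
  filter_upwards [h0] with x hx using sub_eq_zero.1 hx

/-- Makes F(u(s)) a single element of L^p, so that nonlinearities obtained in different ways can be
identified. -/
lemma IsAdvection.unique (hq : IsDomainMap q) {a b w w' : X → E d} (hw : IsAdvection q a b w)
    (hw' : IsAdvection q a b w') : w =ᵐ[volume] w' := by
  obtain ⟨g, hg, hwg⟩ := hw
  obtain ⟨g', hg', hwg'⟩ := hw'
  have h0 : ∀ᵐ x, ∀ j, g j x = g' j x := ae_all_iff.2 fun j => (hg j).unique hq (hg' j)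
  filter_upwards [hwg, hwg', h0] with x h1 h2 h3
  rw [h1, h2]
  simp_rw [h3]

variable [Fact (1 ≤ p)]

lemma isSmoothing_heatL (hp : p ≠ ∞) (hq : Continuous q) (hν : 0 < ν) (N : ℝ) :
    IsSmoothing (heatL (X := X) (p := p) hp hq hν) N 1 0 where
  const_nonneg := zero_le_one
  exponent_nonneg := le_rfl
  exponent_lt_one := one_pos
  norm_le t _ _ := by simpa using norm_heatL_le hp hq hν t
  continuousOn := (continuous_heatL hp hq hν).continuousOn

/-- The gradient of the heat semigroup. -/
def heatGradientL (hp : p ≠ ∞) (hq : Continuous q) (hν : 0 < ν) (t : ℝ) :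
    Lp (E d) p (volume : Measure X) →L[ℝ] (Fin d → Lp (E d) p (volume : Measure X)) :=
  ContinuousLinearMap.pi fun j => heatGradL hp hq hν j t

lemma isSmoothing_heatGradientL (hp : p ≠ ∞) (hq : Continuous q) (hν : 0 < ν) (N : ℝ) :
    IsSmoothing (heatGradientL (X := X) (p := p) hp hq hν) N
      (∑ j, ∫ z, ‖heatKernelDeriv d ν j z‖) (1 / 2) where
  const_nonneg := Finset.sum_nonneg fun _ _ => integral_nonneg fun _ => norm_nonneg _
  exponent_nonneg := by norm_num
  exponent_lt_one := by norm_num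
  norm_le t ht _ := by
    have h0 : ∀ j, 0 ≤ ∫ z, ‖heatKernelDeriv d ν j z‖ := fun j =>
      integral_nonneg fun _ => norm_nonneg _
    have hC : 0 ≤ ∑ j, ∫ z, ‖heatKernelDeriv d ν j z‖ := Finset.sum_nonneg fun j _ => h0 j
    refine ContinuousLinearMap.opNorm_le_bound _ (by positivity) fun h => ?_
    refine (pi_norm_le_iff_of_nonneg (by positivity)).2 fun j => ?_
    change ‖(√t)⁻¹ • average hp hq (integrable_heatKernelDeriv hν j) t h‖ ≤ _
    have hs : ‖(√t)⁻¹‖ = t ^ (-(1 / 2 : ℝ)) := by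
      rw [Real.norm_of_nonneg (by positivity), Real.sqrt_eq_rpow, Real.rpow_neg ht.le]
    rw [norm_smul, hs, mul_comm (∑ j, _), mul_assoc]
    gcongr
    refine (ContinuousLinearMap.le_of_opNorm_le _ (norm_average_le hp hq _ t) h).trans ?_
    gcongr
    exact Finset.single_le_sum (fun j _ => h0 j) (Finset.mem_univ j)
  continuousOn := by
    refine continuousOn_pi.2 fun j => ?_
    change ContinuousOn (fun x : ℝ × Lp (E d) p (volume : Measure X) =>
      (√x.1)⁻¹ • average hp hq (integrable_heatKernelDeriv hν j) x.1 x.2) _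
    have hc : ContinuousOn (fun x : ℝ × Lp (E d) p (volume : Measure X) => (√x.1)⁻¹)
        (Set.Ioc 0 N ×ˢ Set.univ) :=
      (Real.continuous_sqrt.comp continuous_fst).continuousOn.inv₀ fun x hx =>
        (Real.sqrt_pos.2 hx.1.1).ne'
    exact hc.smul (continuous_average hp hq _).continuousOn

/-- The bilinear map `(a, (b_j)) ↦ ∑ j, a^j b_j` on `L^∞ × (L^p)^d`. -/
def advectionL (d : ℕ) (X : Type) [MeasureSpace X] (p : ℝ≥0∞) [Fact (1 ≤ p)] :
    Lp (E d) ∞ (volume : Measure X) →L[ℝ] (Fin d → Lp (E d) p (volume : Measure X)) →L[ℝ]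
      Lp (E d) p (volume : Measure X) :=
  ∑ j, (ContinuousLinearMap.holderL (volume : Measure X) ∞ p p
    (ContinuousLinearMap.lsmul ℝ ℝ)).bilinearComp
      (ContinuousLinearMap.compLpL ∞ (volume : Measure X) (EuclideanSpace.proj j : E d →L[ℝ] ℝ))
      (ContinuousLinearMap.proj j)

lemma coeFn_Lp_sum {ι : Type*} [Fintype ι] (h : ι → Lp (E d) p (volume : Measure X)) :
    ((∑ i, h i : Lp (E d) p (volume : Measure X)) : X → E d) =ᵐ[volume] fun x => ∑ i, h i x := by
  classical
  have key : ∀ s : Finset ι, ((∑ i ∈ s, h i : Lp (E d) p (volume : Measure X)) : X → E d)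
      =ᵐ[volume] fun x => ∑ i ∈ s, h i x := fun s => by
    induction s using Finset.induction_on with
    | empty =>
      filter_upwards [Lp.coeFn_zero (E d) p (volume : Measure X)] with x hx
      rw [Finset.sum_empty, Finset.sum_empty, hx, Pi.zero_apply]
    | insert i s hi ih =>
      rw [Finset.sum_insert hi]
      filter_upwards [Lp.coeFn_add (h i) (∑ i ∈ s, h i), ih] with x h1 h2
      rw [h1, Pi.add_apply, h2, Finset.sum_insert hi]
  exact key Finset.univ

lemma coeFn_advectionL (a : Lp (E d) ∞ (volume : Measure X))
    (b : Fin d → Lp (E d) p (volume : Measure X)) :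
    advectionL d X p a b =ᵐ[volume] fun x => ∑ j, a x j • b j x := by
  have h1 : advectionL d X p a b = ∑ j, ContinuousLinearMap.holder p (ContinuousLinearMap.lsmul ℝ ℝ)
      (ContinuousLinearMap.compLpL ∞ (volume : Measure X) (EuclideanSpace.proj j : E d →L[ℝ] ℝ) a) (b j) := by
    simp only [advectionL, _root_.sum_apply]
    rfl
  rw [h1]
  refine (coeFn_Lp_sum _).trans ?_
  have h2 : ∀ᵐ x, ∀ j : Fin d,
      (ContinuousLinearMap.compLpL ∞ (volume : Measure X) (EuclideanSpace.proj j : E d →L[ℝ] ℝ) a) x = a x j :=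
    ae_all_iff.2 fun j => ContinuousLinearMap.coeFn_compLpL (EuclideanSpace.proj j : E d →L[ℝ] ℝ) a
  have h3 := ae_all_iff.2 fun j : Fin d => ContinuousLinearMap.coeFn_holder (r := p)
      (ContinuousLinearMap.lsmul ℝ ℝ)
      (ContinuousLinearMap.compLpL ∞ (volume : Measure X) (EuclideanSpace.proj j : E d →L[ℝ] ℝ) a) (b j)
  filter_upwards [h2, h3] with x hx2 hx3
  simp [hx2, hx3]

lemma isAdvection_advectionL {a : Lp (E d) ∞ (volume : Measure X)}
    {v : Lp (E d) p (volume : Measure X)} {b : Fin d → Lp (E d) p (volume : Measure X)}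
    (hav : a =ᵐ[volume] v) (hb : ∀ j, IsWeakPartial q j v (b j)) :
    IsAdvection q v v (advectionL d X p a b) := by
  refine ⟨fun j => b j, hb, ?_⟩
  filter_upwards [coeFn_advectionL a b, hav] with x h1 h2
  rw [h1, h2]

/-- For almost every time the Duhamel integral `v` of the heat semigroup is bounded and weakly
differentiable, and `(v · ∇) v` is given by the Duhamel integrals of the `L^p → L^∞` heat semigroup
and of its gradient. -/
lemma ae_isAdvection_duhamel (hp : p ≠ ∞) (hq : IsDomainMap q) (hν : 0 < ν)
    {A : ℝ → Lp (E d) p (volume : Measure X) →L[ℝ] Lp (E d) ∞ (volume : Measure X)} {C a : ℝ}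
    (hA : IsSmoothing A N C a)
    (hAe : ∀ t, 0 < t → t ≤ N → ∀ h, A t h =ᵐ[volume] heatL hp hq.continuous hν t h)
    (hτ : τ ≤ N) (u : Lp (E d) p (volume : Measure X)) {g : ℝ → Lp (E d) p (volume : Measure X)}
    (hg : IntegrableOn g (Set.Ioc 0 τ)) :
    ∀ᵐ t ∂(volume.restrict (Set.Ioc 0 τ)),
      IsAdvection q
        (duhamel (heatL hp hq.continuous hν) u g t : Lp (E d) p (volume : Measure X))
        (duhamel (heatL hp hq.continuous hν) u g t : Lp (E d) p (volume : Measure X))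
        (advectionL d X p (duhamel A u g t)
          (duhamel (heatGradientL hp hq.continuous hν) u g t)) := by
  filter_upwards [(isSmoothing_heatL hp hq.continuous hν N).ae_intervalIntegrable hτ hg,
    (isSmoothing_heatGradientL hp hq.continuous hν N).ae_intervalIntegrable hτ hg,
    hA.ae_intervalIntegrable hτ hg, ae_restrict_mem measurableSet_Ioc] with t hS hK hA' ht
  refine isAdvection_advectionL ?_ fun j => ?_
  -- The two Duhamel integrals live in different spaces, L^∞ and L^p. They are compared through
  -- their pairings with test functions, which are continuous on both.
  · have h0 := hq.ae_eq_zero (fun x => duhamel A u g t x -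
      duhamel (heatL hp hq.continuous hν) u g t x)
      ((Lp_locallyIntegrable _).sub (Lp_locallyIntegrable _)) fun φ hφ => by
        have hφc := hφ.continuous hq
        obtain ⟨Λ, hΛ⟩ := exists_pairing (d := d) (p := ∞) hφc hφ.2
        obtain ⟨Λ', hΛ'⟩ := exists_pairing (d := d) (p := p) hφc hφ.2
        simp_rw [smul_sub]
        rw [integral_sub
          ((Lp_locallyIntegrable _).integrable_smul_left_of_hasCompactSupport hφc hφ.2)
          ((Lp_locallyIntegrable _).integrable_smul_left_of_hasCompactSupport hφc hφ.2),
          ← hΛ, ← hΛ', sub_eq_zero]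
        refine map_duhamel_eq Λ Λ' ht.1 (fun s hs hst y => ?_) hA' hS u
        rw [hΛ, hΛ']
        refine integral_congr_ae ?_
        filter_upwards [hAe s hs (hst.trans (ht.2.trans hτ)) y] with x hx
        rw [hx]
    filter_upwards [h0] with x hx using sub_eq_zero.1 hx
  · rw [isWeakPartial_iff]
    intro φ hφ
    obtain ⟨Λ, hΛ⟩ := exists_pairing (d := d) (p := p) (hφ.continuous hq) hφ.2
    obtain ⟨Λ', hΛ'⟩ := exists_pairing (d := d) (p := p) (hφ.continuous_partialDeriv (j := j) hq)
      (hφ.hasCompactSupport_partialDeriv hq)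
    rw [← hΛ, ← hΛ']
    -- The weak derivative identity holds for each operator of the family, and bounded functionals
    -- carry it through the time integral.
    refine map_duhamel_eq (Λ ∘L ContinuousLinearMap.proj j) (-Λ') ht.1 (fun s hs _ y => ?_) hK hS u
    change Λ (heatGradL hp hq.continuous hν j s y) = -Λ' _
    rw [hΛ, hΛ']
    exact (isWeakPartial_iff _ _).1 (isWeakPartial_heatL hp hq hν hs y) φ hφ

end Advection

/-! ### Time shifts, restarting, and the nonlinearity of a local solution. -/

lemma duhamel_congr {Y Z : Type*} [NormedAddCommGroup Y] [NormedSpace ℝ Y]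
    [NormedAddCommGroup Z] [NormedSpace ℝ Z] (R : ℝ → Y →L[ℝ] Z) (u : Y) {g g' : ℝ → Y} {t : ℝ}
    (ht : 0 ≤ t) (h : ∀ᵐ s ∂(volume.restrict (Set.Ioc 0 t)), g s = g' s) :
    duhamel R u g t = duhamel R u g' t := by
  unfold duhamel
  rw [intervalIntegral.integral_of_le ht, intervalIntegral.integral_of_le ht]
  congr 1
  refine integral_congr_ae ?_
  filter_upwards [h] with s hs
  rw [hs]

lemma integrableOn_Ioc_comp_add_left {Y : Type*} [NormedAddCommGroup Y] {g : ℝ → Y} {a b : ℝ}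
    (hab : a ≤ b) (hg : IntegrableOn g (Set.Ioc a b)) :
    IntegrableOn (fun t => g (a + t)) (Set.Ioc 0 (b - a)) := by
  have h := ((intervalIntegrable_iff_integrableOn_Ioc_of_le hab).2 hg).comp_add_left a
  rwa [sub_self, intervalIntegrable_iff_integrableOn_Ioc_of_le (by linarith)] at h

lemma setIntegral_Ioc_comp_add_left (g : ℝ → ℝ) {a b : ℝ} (hab : a ≤ b) :
    ∫ t in Set.Ioc 0 (b - a), g (a + t) = ∫ s in Set.Ioc a b, g s := by
  rw [← intervalIntegral.integral_of_le (by linarith), ← intervalIntegral.integral_of_le hab,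
    intervalIntegral.integral_comp_add_left g a]
  simp

lemma ae_Ioc_comp_add_left {P : ℝ → Prop} {a b : ℝ}
    (h : ∀ᵐ s ∂(volume.restrict (Set.Ioc a b)), P s) :
    ∀ᵐ t ∂(volume.restrict (Set.Ioc 0 (b - a))), P (a + t) := by
  rw [ae_restrict_iff' measurableSet_Ioc] at h ⊢
  filter_upwards [(measurePreserving_add_left volume a).quasiMeasurePreserving.ae h] with t ht htm
  exact ht ⟨by linarith [htm.1], by linarith [htm.2]⟩

lemma ae_Ioc_of_ae_Ioc_sub {P : ℝ → Prop} {a b : ℝ}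
    (h : ∀ᵐ t ∂(volume.restrict (Set.Ioc 0 (b - a))), P t) :
    ∀ᵐ s ∂(volume.restrict (Set.Ioc a b)), P (s - a) := by
  rw [ae_restrict_iff' measurableSet_Ioc] at h ⊢
  filter_upwards [(measurePreserving_sub_right volume a).quasiMeasurePreserving.ae h] with t ht htm
  exact ht ⟨by linarith [htm.1], by linarith [htm.2]⟩

/-- A continuous function starting at `0` that stays below `1/2` as long as it stays below `1` stays
below `1`. -/
lemma le_one_of_bootstrap {y : ℝ → ℝ} {r : ℝ} (hr : 0 ≤ r) (hy : ContinuousOn y (Set.Icc 0 r))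
    (hy0 : y 0 = 0) (h : ∀ s ∈ Set.Icc 0 r, y s ≤ 1 → y s ≤ 1 / 2) : y r ≤ 1 := by
  by_contra! hlt
  obtain ⟨s, hs, hs1⟩ := intermediate_value_Icc hr hy 
    (show (1 : ℝ) ∈ Set.Icc (y 0) (y r) from ⟨by simp [hy0], hlt.le⟩)
  have := h s hs hs1.le
  norm_num [hs1] at this

section Continuation

variable {d : ℕ} {X : Type} [AddCommGroup X] [TopologicalSpace X] [IsTopologicalAddGroup X]
  [T2Space X] [SecondCountableTopology X] [LocallyCompactSpace X] [MeasureSpace X] [BorelSpace X]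
  [IsLocallyFiniteMeasure (volume : Measure X)] [(volume : Measure X).IsAddRightInvariant]
  {p : ℝ≥0∞} [Fact (1 ≤ p)] {q : E d → X} {ν : ℝ}

lemma integrableOn_heatL_comp (hp : p ≠ ∞) (hq : Continuous q) (hν : 0 < ν) (c : ℝ) {I : Set ℝ}
    {g : ℝ → Lp (E d) p (volume : Measure X)} (hg : IntegrableOn g I) :
    IntegrableOn (fun s => heatL hp hq hν (c - s) (g s)) I := by
  refine Integrable.mono hg ?_ (Eventually.of_forall fun s => ?_)
  · refine (continuous_heatL hp hq hν).comp_aestronglyMeasurable (f := fun s => (c - s, g s)) ?_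
    exact (by fun_prop : Continuous fun s : ℝ => c - s).aestronglyMeasurable.prodMk hg.1
  · simpa using (heatL hp hq hν (c - s)).le_of_opNorm_le (norm_heatL_le hp hq hν _) (g s)

lemma norm_duhamel_heatL_le (hp : p ≠ ∞) (hq : Continuous q) (hν : 0 < ν)
    (u₀ : Lp (E d) p (volume : Measure X)) {g : ℝ → Lp (E d) p (volume : Measure X)} {t T : ℝ}
    (ht : 0 ≤ t) (htT : t ≤ T) (hg : IntegrableOn g (Set.Ioc 0 T)) :
    ‖duhamel (heatL hp hq hν) u₀ g t‖ ≤ ‖u₀‖ + ∫ s in Set.Ioc 0 T, ‖g s‖ := by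
  have hle : ∀ (r : ℝ) (y : Lp (E d) p (volume : Measure X)), ‖heatL hp hq hν r y‖ ≤ ‖y‖ :=
    fun r y => by simpa using (heatL hp hq hν r).le_of_opNorm_le (norm_heatL_le hp hq hν _) y
  refine (norm_add_le _ _).trans (add_le_add (hle _ _) ?_)
  rw [intervalIntegral.integral_of_le ht]
  refine (norm_integral_le_of_norm_le (hg.mono_set (Set.Ioc_subset_Ioc_right htT)).norm
    (Eventually.of_forall fun s => hle _ _)).trans ?_
  exact setIntegral_mono_set hg.norm (Eventually.of_forall fun _ => norm_nonneg _)
    (LE.le.eventuallyLE (Set.Ioc_subset_Ioc_right htT))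

/-- The mild formula can be restarted at any time. -/
lemma duhamel_heatL_add (hp : p ≠ ∞) (hq : IsDomainMap q) (hν : 0 < ν)
    (u₀ : Lp (E d) p (volume : Measure X)) {g : ℝ → Lp (E d) p (volume : Measure X)} {a t : ℝ}
    (ha : 0 ≤ a) (ht : 0 ≤ t) (hg : IntegrableOn g (Set.Ioc 0 (a + t))) :
    duhamel (heatL hp hq.continuous hν) u₀ g (a + t) =
      duhamel (heatL hp hq.continuous hν) (duhamel (heatL hp hq.continuous hν) u₀ g a)
        (fun s => g (a + s)) t := by
  set S := heatL (p := p) hp hq.continuous hν with hS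
  have hi : ∀ (c x y : ℝ), 0 ≤ x → x ≤ y → y ≤ a + t →
      IntervalIntegrable (fun s => S (c - s) (g s)) volume x y := fun c x y hx hxy hy => by
    rw [intervalIntegrable_iff_integrableOn_Ioc_of_le hxy]
    exact integrableOn_heatL_comp hp hq.continuous hν c (hg.mono_set (Set.Ioc_subset_Ioc hx hy))
  have h1 : S t (∫ s in (0 : ℝ)..a, S (a - s) (g s)) = ∫ s in (0 : ℝ)..a, S (a + t - s) (g s) := by
    rw [← (S t).intervalIntegral_comp_comm (hi a 0 a le_rfl ha (by linarith))]
    refine intervalIntegral.integral_congr fun s hs => ?_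
    rw [Set.uIcc_of_le ha] at hs
    rw [hS, heatL_heatL hp hq.continuous hq.map_add hν ht (by linarith [hs.2])]
    congr 1
    ring_nf
  have h2 : ∫ s in (0 : ℝ)..t, S (t - s) (g (a + s)) =
      ∫ s in a..(a + t), S (a + t - s) (g s) := by
    have := intervalIntegral.integral_comp_add_left (a := 0) (b := t)
      (fun s => S (a + t - s) (g s)) a
    rw [add_zero] at this
    rw [← this]
    refine intervalIntegral.integral_congr fun s _ => ?_
    congr 2
    ring
  unfold duhamel
  rw [map_add, h1, h2, heatL_heatL hp hq.continuous hq.map_add hν ht ha, add_comm t a, add_assoc,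
    intervalIntegral.integral_add_adjacent_intervals (hi _ 0 a le_rfl ha (by linarith))
      (hi _ a (a + t) ha (by linarith) le_rfl)]

lemma mild_eq_duhamel (hp : p ≠ ∞) (hq : IsDomainMap q) (hν : 0 < ν)
    (u₀ : Lp (E d) p (volume : Measure X)) (f w : ℝ → Lp (E d) p (volume : Measure X)) (t : ℝ) :
    heat q ν t u₀ - ∫ s in (0 : ℝ)..t, heat q ν (t - s) (w s - f s) =
      duhamel (heatL hp hq.continuous hν) u₀ (fun s => f s - w s) t := by
  simp_rw [heat_eq_heatL hp hq.continuous hq.map_zero hν]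
  unfold duhamel
  rw [sub_eq_add_neg, ← intervalIntegral.integral_neg]
  simp_rw [← map_neg, neg_sub]

/-- The nonlinearity `F(u)` of a function that is a mild solution on `[0, t]` for all `t < T`. -/
lemma exists_nonlinearity (hp : p ≠ ∞) (hq : IsDomainMap q) (hν : 0 < ν)
    {u₀ : Lp (E d) p (volume : Measure X)} {f u : ℝ → Lp (E d) p (volume : Measure X)} {T : ℝ}
    (hT : 0 < T) (hu : ∀ t, 0 < t → t < T → IsMildSolution q ν u₀ f t u) :
    ∃ W : ℝ → Lp (E d) p (volume : Measure X),
      (∀ t, t < T → IntegrableOn W (Set.Ioc 0 t)) ∧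
      (∀ᵐ s ∂(volume.restrict (Set.Ioc 0 T)), IsAdvection q (u s) (u s) (W s)) ∧
      ∀ t, 0 ≤ t → t < T →
        u t = duhamel (heatL hp hq.continuous hν) u₀ (fun s => f s - W s) t := by
  classical
  -- The definition of mild solution provides a nonlinearity for each t separately. Choosing it
  -- pointwise in s gives one function for all t, which by uniqueness agrees almost everywhere with
  -- each of them.
  set W : ℝ → Lp (E d) p (volume : Measure X) := fun s =>
    if h : ∃ w : Lp (E d) p (volume : Measure X), IsAdvection q (u s) (u s) w then h.choose else 0
    with hW
  have hWeq : ∀ (s : ℝ) (w : Lp (E d) p (volume : Measure X)),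
      IsAdvection q (u s) (u s) w → W s = w := fun s w hw => by
    have hex : ∃ w : Lp (E d) p (volume : Measure X), IsAdvection q (u s) (u s) w := ⟨w, hw⟩
    rw [hW]
    simp only [dif_pos hex]
    exact Lp.ext (hex.choose_spec.unique hq hw)
  have key : ∀ t, 0 < t → t < T → IntegrableOn W (Set.Ioc 0 t) ∧
      (∀ᵐ s ∂(volume.restrict (Set.Ioc 0 t)), IsAdvection q (u s) (u s) (W s)) ∧
      ∀ s ∈ Set.Icc 0 t, u s = duhamel (heatL hp hq.continuous hν) u₀ (fun s => f s - W s) s := by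
    intro t ht htT
    obtain ⟨-, -, w, hwi, hwa, hwu⟩ := hu t ht htT
    have hae : ∀ᵐ s ∂(volume.restrict (Set.Ioc 0 t)), w s = W s := by
      filter_upwards [hwa] with s hs using (hWeq s _ hs).symm
    refine ⟨hwi.congr hae, ?_, fun s hs => ?_⟩
    · filter_upwards [hwa, hae] with s h1 h2
      rwa [← h2]
    · rw [hwu s hs, mild_eq_duhamel hp hq hν]
      refine duhamel_congr _ _ hs.1 ?_
      filter_upwards [ae_restrict_of_ae_restrict_of_subset (Set.Ioc_subset_Ioc_right hs.2) hae]
        with r hr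
      rw [hr]
  refine ⟨W, fun t htT => ?_, ?_, fun t ht htT => ?_⟩
  · rcases le_or_gt t 0 with h0 | h0
    · simp [Set.Ioc_eq_empty_of_le h0]
    · exact (key t h0 htT).1
  · have h1 : ∀ n : ℕ, ∀ᵐ s, s ∈ Set.Ioc 0 (T - T / (n + 2)) → IsAdvection q (u s) (u s) (W s) :=
      fun n => by
        rw [← ae_restrict_iff' measurableSet_Ioc]
        have h2 : 0 < T / ((n : ℝ) + 2) := by positivity
        have h3 : T / ((n : ℝ) + 2) < T := div_lt_self hT (by linarith [n.cast_nonneg (α := ℝ)])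
        exact (key _ (by linarith) (by linarith)).2.1
    rw [← restrict_Ioo_eq_restrict_Ioc, ae_restrict_iff' measurableSet_Ioo]
    filter_upwards [ae_all_iff.2 h1] with s hs hsm
    have hlim : Tendsto (fun n : ℕ => T / ((n : ℝ) + 2)) atTop (𝓝 0) :=
      tendsto_const_nhds.div_atTop
        (tendsto_atTop_add_const_right _ _ tendsto_natCast_atTop_atTop)
    obtain ⟨n, hn⟩ := (hlim.eventually_lt_const (sub_pos.2 hsm.2)).exists
    exact hs n ⟨hsm.1, by linarith⟩
  · exact (key ((t + T) / 2) (by linarith) (by linarith)).2.2 t ⟨ht, by linarith⟩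

end Continuation

/-! ### A priori bound, continuation and blow-up. -/

section Blowup

variable {d : ℕ} {X : Type} [AddCommGroup X] [TopologicalSpace X] [IsTopologicalAddGroup X]
  [T2Space X] [SecondCountableTopology X] [LocallyCompactSpace X] [MeasureSpace X] [BorelSpace X]
  [IsLocallyFiniteMeasure (volume : Measure X)] [(volume : Measure X).IsAddRightInvariant]
  {p : ℝ≥0∞} [Fact (1 ≤ p)] {q : E d → X} {ν : ℝ}

/-- The condition d < p enters here: it says that d/2p < 1/2, so that the order together with the
order 1/2 of the gradient stays below 1. -/
lemma exists_smoothing_Linfty (hp : p ≠ ∞) (hdp : (d : ℝ≥0∞) < p) (hq : IsDomainMap q)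
    (hν : 0 < ν) :
    ∃ (C a : ℝ) (A : ℝ → Lp (E d) p (volume : Measure X) →L[ℝ] Lp (E d) ∞ (volume : Measure X)),
      IsSmoothing A 1 C a ∧ a + 1 / 2 < 1 ∧
      ∀ t, 0 < t → t ≤ 1 → ∀ h, A t h =ᵐ[volume] heatL hp hq.continuous hν t h := by
  obtain ⟨C, A, hC, hA, hAe, hAc⟩ := exists_heat_Linfty (p := p) hp hq hν
  have hdp' : (d : ℝ) < p.toReal := by
    have := (ENNReal.toReal_lt_toReal (ENNReal.natCast_ne_top d) hp).2 hdp
    simpa using this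
  have hp0 : 0 < p.toReal := (Nat.cast_nonneg d).trans_lt hdp'
  have h1 : d / (2 * p.toReal) < 1 / 2 := by
    rw [div_lt_div_iff₀ (by positivity) (by norm_num)]
    linarith
  exact ⟨C, d / (2 * p.toReal), A, ⟨hC, by positivity, by linarith, hA, hAc⟩, by linarith, hAe⟩

/-- If a mild solution stays bounded in `L^p` up to time `T`, then its nonlinearity is integrable
up to time `T`. -/
lemma integrableOn_nonlinearity (hp : p ≠ ∞) (hdp : (d : ℝ≥0∞) < p) (hq : IsDomainMap q)
    (hν : 0 < ν) {u₀ : Lp (E d) p (volume : Measure X)}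
    {f u W : ℝ → Lp (E d) p (volume : Measure X)} {T ε M : ℝ} (hT : 0 < T) (hε : 0 < ε)
    (hf : IntegrableOn f (Set.Ioc 0 T)) (hM : ∀ t, T - ε < t → t < T → ‖u t‖ ≤ M)
    (hWi : ∀ t, t < T → IntegrableOn W (Set.Ioc 0 t))
    (hWa : ∀ᵐ s ∂(volume.restrict (Set.Ioc 0 T)), IsAdvection q (u s) (u s) (W s))
    (hu : ∀ t, 0 ≤ t → t < T →
      u t = duhamel (heatL hp hq.continuous hν) u₀ (fun s => f s - W s) t) :
    IntegrableOn W (Set.Ioc 0 T) := by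
  obtain ⟨C, a, A, hA, ha, hAe⟩ := exists_smoothing_Linfty (p := p) hp hdp hq hν
  have hK := isSmoothing_heatGradientL (X := X) (p := p) hp hq.continuous hν 1
  set C' := ∑ j, ∫ z, ‖heatKernelDeriv d ν j z‖ with hC'
  have hC0 := hA.const_nonneg
  have hC0' : 0 ≤ C' := hK.const_nonneg
  have hc : 0 < 1 - (a + 1 / 2) := by linarith
  -- Bounds the mass of the data after a restart: |M| for the initial value, the integral of ‖f‖,
  -- and 1 for the part of ∫‖W‖ admitted in the bootstrap.
  set M' : ℝ := |M| + (∫ s in Set.Ioc 0 T, ‖f s‖) + 1 with hM'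
  have hM'0 : 0 ≤ M' := by
    have : 0 ≤ ∫ s in Set.Ioc 0 T, ‖f s‖ := integral_nonneg fun _ => norm_nonneg _
    positivity
  set D : ℝ := ‖advectionL d X p‖ * C * C' * (2 / (1 - (a + 1 / 2))) with hD
  have hD0 : 0 ≤ D := by positivity
  obtain ⟨σ, hσ, hσ1, hsmall⟩ := exists_rpow_mul_le hc
    (by positivity : 0 ≤ D * M' * M') (by norm_num : (0 : ℝ) < 1 / 2) one_pos
  -- σ depends on M' but not on the restart time, so t₀ can be taken within σ of T and one bootstrap
  -- interval reaches T.
  obtain ⟨t₀, ht₀, ht₀T⟩ : ∃ t₀, max 0 (max (T - ε) (T - σ)) < t₀ ∧ t₀ < T :=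
    exists_between (max_lt hT (max_lt (by linarith) (by linarith)))
  simp only [max_lt_iff] at ht₀
  obtain ⟨ht₀0, ht₀ε, ht₀σ⟩ := ht₀
  have hbound : ∀ b, t₀ ≤ b → b < T → ∫ s in Set.Ioc t₀ b, ‖W s‖ ≤ 1 := by
    intro b hb hbT
    have hWb : IntegrableOn (fun t => W (t₀ + t)) (Set.Ioc 0 (b - t₀)) :=
      integrableOn_Ioc_comp_add_left hb
        ((hWi b hbT).mono_set (Set.Ioc_subset_Ioc_left ht₀0.le))
    have hfb : IntegrableOn (fun t => f (t₀ + t)) (Set.Ioc 0 (b - t₀)) :=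
      integrableOn_Ioc_comp_add_left hb (hf.mono_set (Set.Ioc_subset_Ioc ht₀0.le hbT.le))
    set y : ℝ → ℝ := fun r => ∫ t in (0 : ℝ)..r, ‖W (t₀ + t)‖ with hy
    have hyb : y (b - t₀) = ∫ s in Set.Ioc t₀ b, ‖W s‖ := by
      rw [hy]
      simp only
      rw [intervalIntegral.integral_of_le (by linarith),
        setIntegral_Ioc_comp_add_left (fun s => ‖W s‖) hb]
    rw [← hyb]
    refine le_one_of_bootstrap (by linarith) ?_ (by simp [hy]) fun r hr hyr => ?_
    · have := intervalIntegral.continuousOn_primitive_interval (a := 0) (b := b - t₀)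
        (f := fun t => ‖W (t₀ + t)‖) (μ := volume) (by
          rw [Set.uIcc_of_le (by linarith), integrableOn_Icc_iff_integrableOn_Ioc]
          exact hWb.norm)
      rwa [Set.uIcc_of_le (by linarith)] at this
    have hsub : Set.Ioc 0 r ⊆ Set.Ioc 0 (b - t₀) := Set.Ioc_subset_Ioc_right hr.2
    have hgr : IntegrableOn (fun t => f (t₀ + t) - W (t₀ + t)) (Set.Ioc 0 r) :=
      (hfb.mono_set hsub).sub (hWb.mono_set hsub)
    have hr1 : r ≤ 1 := by linarith [hr.2]
    -- By the restarted mild formula both sides are advection terms of the same function u(t₀ + t),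
    -- so they agree by uniqueness.
    have hWr : ∀ᵐ t ∂(volume.restrict (Set.Ioc 0 r)), W (t₀ + t) = advectionL d X p
        (duhamel A (u t₀) (fun t => f (t₀ + t) - W (t₀ + t)) t)
        (duhamel (heatGradientL hp hq.continuous hν) (u t₀)
          (fun t => f (t₀ + t) - W (t₀ + t)) t) := by
      have h1 := ae_restrict_of_ae_restrict_of_subset
        (Set.Ioc_subset_Ioc ht₀0.le (by linarith [hr.2] : t₀ + r ≤ T)) hWa
      have h2 := ae_Ioc_comp_add_left h1
      rw [add_sub_cancel_left] at h2
      filter_upwards [h2, ae_isAdvection_duhamel hp hq hν hA hAe hr1 (u t₀) hgr,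
        ae_restrict_mem measurableSet_Ioc] with t h3 h4 ht
      have h5 : u (t₀ + t) = duhamel (heatL hp hq.continuous hν) (u t₀)
          (fun t => f (t₀ + t) - W (t₀ + t)) t := by
        have htb : t₀ + t ≤ b := by linarith [ht.2, hr.2]
        rw [hu _ (by linarith [ht.1]) (by linarith), hu t₀ ht₀0.le ht₀T]
        refine duhamel_heatL_add hp hq hν u₀ ht₀0.le ht.1.le ?_
        exact (hf.mono_set (Set.Ioc_subset_Ioc_right (by linarith))).sub (hWi _ (by linarith))
      rw [← h5] at h4
      exact Lp.ext (h3.unique hq h4)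
    have hbil := (bilinear_duhamel (u₁ := u t₀) (u₂ := u t₀) hA hK ha (advectionL d X p) hr.1 hr1
      hgr hgr).2
    have hyeq : y r = ∫ t in Set.Ioc 0 r, ‖advectionL d X p
        (duhamel A (u t₀) (fun t => f (t₀ + t) - W (t₀ + t)) t)
        (duhamel (heatGradientL hp hq.continuous hν) (u t₀)
          (fun t => f (t₀ + t) - W (t₀ + t)) t)‖ := by
      rw [hy]
      simp only
      rw [intervalIntegral.integral_of_le hr.1]
      refine integral_congr_ae ?_
      filter_upwards [hWr] with t ht
      rw [← ht]
    rw [← hyeq] at hbil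
    have hm : ‖u t₀‖ + ∫ t in Set.Ioc 0 r, ‖f (t₀ + t) - W (t₀ + t)‖ ≤ M' := by
      have h1 : ∫ t in Set.Ioc 0 r, ‖f (t₀ + t) - W (t₀ + t)‖ ≤
          ∫ t in Set.Ioc 0 r, (‖f (t₀ + t)‖ + ‖W (t₀ + t)‖) :=
        integral_mono hgr.norm ((hfb.mono_set hsub).norm.add (hWb.mono_set hsub).norm)
          fun t => norm_sub_le _ _
      rw [integral_add (hfb.mono_set hsub).norm (hWb.mono_set hsub).norm,
        ← intervalIntegral.integral_of_le (f := fun t => ‖W (t₀ + t)‖) hr.1] at h1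
      have h2 : ∫ t in Set.Ioc 0 r, ‖f (t₀ + t)‖ ≤ ∫ s in Set.Ioc 0 T, ‖f s‖ := by
        have h3 := setIntegral_Ioc_comp_add_left (fun s => ‖f s‖) (by linarith [hr.1] : t₀ ≤ t₀ + r)
        rw [add_sub_cancel_left] at h3
        rw [h3]
        exact setIntegral_mono_set hf.norm (Eventually.of_forall fun _ => norm_nonneg _)
          (LE.le.eventuallyLE (Set.Ioc_subset_Ioc ht₀0.le (by linarith [hr.2])))
      have h4 : ‖u t₀‖ ≤ |M| := (hM t₀ ht₀ε ht₀T).trans (le_abs_self M)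
      linarith
    have hm0 : 0 ≤ ‖u t₀‖ + ∫ t in Set.Ioc 0 r, ‖f (t₀ + t) - W (t₀ + t)‖ :=
      add_nonneg (norm_nonneg _) (integral_nonneg fun _ => norm_nonneg _)
    have hr0 := hr.1
    calc y r ≤ _ := hbil
      _ ≤ ‖advectionL d X p‖ * C * C' * (2 * (r ^ (1 - (a + 1 / 2)) / (1 - (a + 1 / 2)))) *
          (M' * M') := by gcongr
      _ = D * M' * M' * r ^ (1 - (a + 1 / 2)) := by rw [hD]; ring
      _ ≤ 1 / 2 := hsmall r hr.1 (by linarith [hr.2])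
  have hlate : IntegrableOn W (Set.Ioc t₀ T) := by
    have hlim : Tendsto (fun n : ℕ => T - (T - t₀) / ((n : ℝ) + 2)) atTop (𝓝 T) := by
      have : Tendsto (fun n : ℕ => (T - t₀) / ((n : ℝ) + 2)) atTop (𝓝 0) :=
        tendsto_const_nhds.div_atTop
          (tendsto_atTop_add_const_right _ _ tendsto_natCast_atTop_atTop)
      simpa using this.const_sub T
    have hn : ∀ n : ℕ, t₀ ≤ T - (T - t₀) / ((n : ℝ) + 2) ∧ T - (T - t₀) / ((n : ℝ) + 2) < T :=
      fun n => by
        have h0 : 0 < T - t₀ := by linarith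
        have h2 : 0 < (T - t₀) / ((n : ℝ) + 2) := by positivity
        have h3 : (T - t₀) / ((n : ℝ) + 2) < T - t₀ :=
          div_lt_self h0 (by linarith [n.cast_nonneg (α := ℝ)])
        constructor <;> linarith
    -- The bound 1 is uniform in b < T, so integrability passes to the limit b → T.
    exact integrableOn_Ioc_of_intervalIntegral_norm_bounded_right (I := 1)
      (fun n => (hWi _ (hn n).2).mono_set (Set.Ioc_subset_Ioc_left ht₀0.le)) hlim
      (Eventually.of_forall fun n => hbound _ (hn n).1 (hn n).2)
  rw [← Set.Ioc_union_Ioc_eq_Ioc ht₀0.le ht₀T.le]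
  exact (hWi t₀ ht₀T).union hlate

/-- A mild solution with nonlinearity integrable up to time `T` extends beyond `T`. -/
lemma exists_extension (hp : p ≠ ∞) (hdp : (d : ℝ≥0∞) < p) (hq : IsDomainMap q)
    (hν : 0 < ν) {u₀ : Lp (E d) p (volume : Measure X)}
    {f u W : ℝ → Lp (E d) p (volume : Measure X)} {T T₁ : ℝ} (hT : 0 < T) (hT₁ : T < T₁)
    (hf : IntegrableOn f (Set.Ioc 0 T₁)) (hWi : IntegrableOn W (Set.Ioc 0 T))
    (hWa : ∀ᵐ s ∂(volume.restrict (Set.Ioc 0 T)), IsAdvection q (u s) (u s) (W s))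
    (hu : ∀ t, 0 ≤ t → t < T →
      u t = duhamel (heatL hp hq.continuous hν) u₀ (fun s => f s - W s) t) :
    ∃ T' : ℝ, T < T' ∧ T' ≤ T₁ ∧ ∃ v : ℝ → Lp (E d) p (volume : Measure X),
      Set.EqOn v u (Set.Ico 0 T) ∧ IsMildSolution q ν u₀ f T' v := by
  obtain ⟨C, a, A, hA, ha, hAe⟩ := exists_smoothing_Linfty (p := p) hp hdp hq hν
  have hK := isSmoothing_heatGradientL (X := X) (p := p) hp hq.continuous hν 1
  set S := heatL (p := p) hp hq.continuous hν with hS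
  -- The value at T is supplied by the Duhamel formula, which makes sense there because W is
  -- integrable up to T.
  set u₁ := duhamel S u₀ (fun s => f s - W s) T with hu₁
  set σ₀ : ℝ := min 1 (T₁ - T) with hσ₀
  have hfT : IntegrableOn (fun t => f (T + t)) (Set.Ioc 0 (T₁ - T)) :=
    integrableOn_Ioc_comp_add_left hT₁.le (hf.mono_set (Set.Ioc_subset_Ioc_left hT.le))
  obtain ⟨σ, hσ, hσσ₀, ω, hωi, hω⟩ := exists_duhamel_fixedPoint hA hK ha (advectionL d X p)
    (lt_min one_pos (by linarith)) (min_le_left 1 (T₁ - T)) u₁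
    (hfT.mono_set (Set.Ioc_subset_Ioc_right (min_le_right _ _)))
  have hσ1 : σ ≤ 1 := hσσ₀.trans (min_le_left _ _)
  have hσT : T + σ ≤ T₁ := by linarith [hσσ₀.trans (min_le_right 1 (T₁ - T))]
  have hfσ : IntegrableOn (fun t => f (T + t)) (Set.Ioc 0 σ) :=
    hfT.mono_set (Set.Ioc_subset_Ioc_right (by linarith))
  set w : ℝ → Lp (E d) p (volume : Measure X) := fun s => if s ≤ T then W s else ω (s - T) with hw
  have hwW : ∀ s, s ≤ T → w s = W s := fun s hs => if_pos hs
  have hwω : ∀ s, T < s → w s = ω (s - T) := fun s hs => if_neg (not_le.2 hs)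
  have hwi : IntegrableOn w (Set.Ioc 0 (T + σ)) := by
    rw [← Set.Ioc_union_Ioc_eq_Ioc hT.le (by linarith : T ≤ T + σ)]
    refine IntegrableOn.union (hWi.congr_fun (fun s hs => (hwW s hs.2).symm) measurableSet_Ioc) ?_
    have h1 : IntegrableOn (fun s => ω (s - T)) (Set.Ioc T (T + σ)) := by
      have := ((intervalIntegrable_iff_integrableOn_Ioc_of_le hσ.le).2 hωi).comp_sub_right T
      rwa [zero_add, add_comm σ T, intervalIntegrable_iff_integrableOn_Ioc_of_le (by linarith)]
        at this
    exact h1.congr_fun (fun s hs => (hwω s hs.1).symm) measurableSet_Ioc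
  have hf' : IntegrableOn f (Set.Ioc 0 (T + σ)) := hf.mono_set (Set.Ioc_subset_Ioc_right hσT)
  have hgi : IntegrableOn (fun s => f s - w s) (Set.Ioc 0 (T + σ)) := hf'.sub hwi
  set v := duhamel S u₀ (fun s => f s - w s) with hv
  have hvW : ∀ t, 0 ≤ t → t ≤ T → v t = duhamel S u₀ (fun s => f s - W s) t := fun t h0 h1 => by
    refine duhamel_congr _ _ h0 ?_
    filter_upwards [ae_restrict_mem measurableSet_Ioc] with s hs
    rw [hwW s (hs.2.trans h1)]
  have hvu : ∀ t, 0 ≤ t → t < T → v t = u t := fun t h0 h1 => by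
    rw [hvW t h0 h1.le, hu t h0 h1]
  -- After T the glued function is the Duhamel integral started at u₁ with source f - ω, exactly the
  -- function for which ω was constructed.
  have hvω : ∀ t, 0 ≤ t → t ≤ σ → v (T + t) = duhamel S u₁ (fun s => f (T + s) - ω s) t :=
    fun t h0 h1 => by
    rw [hv, hS, duhamel_heatL_add hp hq hν u₀ hT.le h0 (hgi.mono_set
      (Set.Ioc_subset_Ioc_right (by linarith))), ← hS]
    change duhamel S (v T) _ _ = _
    rw [hvW T hT.le le_rfl]
    refine duhamel_congr _ _ h0 ?_
    filter_upwards [ae_restrict_mem measurableSet_Ioc] with s hs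
    rw [hwω _ (by linarith [hs.1]), add_sub_cancel_left]
  refine ⟨T + σ, by linarith, hσT, v, fun t ht => hvu t ht.1 ht.2, hf', ?_, w, hwi, ?_,
    fun t _ => (mild_eq_duhamel hp hq hν u₀ f w t).symm⟩
  · refine memLp_top_of_bound ((isSmoothing_heatL hp hq.continuous hν
      (T + σ)).aestronglyMeasurable_duhamel le_rfl hgi)
      (‖u₀‖ + ∫ s in Set.Ioc 0 (T + σ), ‖f s - w s‖) ?_
    filter_upwards [ae_restrict_mem measurableSet_Ioc] with t ht
    exact norm_duhamel_heatL_le hp hq.continuous hν u₀ ht.1.le ht.2 hgi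
  · rw [← Set.Ioc_union_Ioc_eq_Ioc hT.le (by linarith : T ≤ T + σ), ae_restrict_union_iff]
    constructor
    · rw [← restrict_Ioo_eq_restrict_Ioc] at hWa ⊢
      filter_upwards [hWa, ae_restrict_mem measurableSet_Ioo] with s hs hsm
      rwa [hvu s hsm.1.le hsm.2, hwW s hsm.2.le]
    · have h1 : ∀ᵐ t ∂(volume.restrict (Set.Ioc 0 σ)),
          IsAdvection q (v (T + t)) (v (T + t)) (ω t) := by
        filter_upwards [hω, ae_isAdvection_duhamel hp hq hν hA hAe hσ1 u₁ (hfσ.sub hωi),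
          ae_restrict_mem measurableSet_Ioc] with t h2 h3 ht
        rw [hvω t ht.1.le ht.2, h2]
        exact h3
      have h2 : ∀ᵐ t ∂(volume.restrict (Set.Ioc 0 (T + σ - T))),
          IsAdvection q (v (T + t)) (v (T + t)) (ω t) := by rwa [add_sub_cancel_left]
      filter_upwards [ae_Ioc_of_ae_Ioc_sub h2, ae_restrict_mem measurableSet_Ioc] with s h3 hs
      rw [add_sub_cancel] at h3
      rwa [hwω s hs.1]

theorem limsup_enorm_sq_eq_top (hp : p ≠ ∞) (hdp : (d : ℝ≥0∞) < p) (hq : IsDomainMap q)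
    (hν : 0 < ν) {T Tmax : ℝ} (hT : Tmax < T) {r : ℝ≥0∞} {u₀ : Lp (E d) p (volume : Measure X)}
    {f u : ℝ → Lp (E d) p (volume : Measure X)} (hf : IsBoundedForce r T f)
    (hu : IsMaximalMildSolution q ν u₀ T f Tmax u) :
    limsup (fun t => ‖u t‖ₑ ^ 2) (𝓝[<] Tmax) = ∞ := by
  obtain ⟨hT0, hmild, hmax⟩ := hu
  by_contra hne
  refine hmax ?_
  -- A finite limsup leaves room for a finite c above it, and √c bounds the norm on a left
  -- neighbourhood of `Tmax`.
  obtain ⟨c, hc, hctop⟩ := exists_between (lt_top_iff_ne_top.2 hne)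
  have hev := eventually_lt_of_limsup_lt hc
  obtain ⟨l, hl, hlT⟩ := (mem_nhdsLT_iff_exists_Ioo_subset).1 hev
  have hM : ∀ t, Tmax - (Tmax - l) < t → t < Tmax → ‖u t‖ ≤ √c.toReal := fun t h1 h2 => by
    have h3 : ‖u t‖ₑ ^ 2 < c := hlT ⟨by linarith, h2⟩
    refine Real.le_sqrt_of_sq_le ?_
    have h4 := ENNReal.toReal_mono hctop.ne h3.le
    simpa [ENNReal.toReal_pow] using h4
  have hfi : IntegrableOn f (Set.Ioc 0 T) := hf.1.integrable le_top
  obtain ⟨W, hWi, hWa, hWu⟩ := exists_nonlinearity hp hq hν hT0 hmild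
  have hWT := integrableOn_nonlinearity hp hdp hq hν hT0 (sub_pos.2 hl)
    (hfi.mono_set (Set.Ioc_subset_Ioc_right hT.le)) hM hWi hWa hWu
  exact exists_extension hp hdp hq hν hT0 hT hfi hWT hWa hWu

end Blowup

/-! ### The whole space and the torus as domains. -/

lemma isDomainMap_id (d : ℕ) : IsDomainMap (id : E d → E d) where
  map_add _ _ := rfl
  isOpenQuotientMap := .id
  exists_cell := ⟨Metric.ball 0 1, measurableSet_ball, Metric.isBounded_ball,
    (Metric.isOpen_ball.measure_pos volume ⟨0, by simp⟩).ne', fun _ _ => setLIntegral_le_lintegral _ _⟩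
  ae_eq_zero h hh H := ae_eq_zero_of_integral_contDiff_smul_eq_zero hh fun φ hφ hφc =>
    H φ ⟨hφ, hφc⟩

section Torus

variable (d : ℕ) (L : ℝ) [hL : Fact (0 < L)]

/-- The open fundamental cell `(0, L)^d` of the torus. -/
def torusCell : Set (E d) := (WithLp.ofLp : E d → Fin d → ℝ) ⁻¹' Set.univ.pi fun _ => Set.Ioo 0 L

lemma isOpen_torusCell : IsOpen (torusCell d L) :=
  (isOpen_set_pi Set.finite_univ fun _ _ => isOpen_Ioo).preimage (PiLp.continuous_ofLp 2 _)

lemma torusCell_nonempty : (torusCell d L).Nonempty :=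
  ⟨WithLp.toLp 2 fun _ => L / 2, fun _ _ => ⟨half_pos hL.out, half_lt_self hL.out⟩⟩

lemma isBounded_torusCell : Bornology.IsBounded (torusCell d L) := by
  have hc : IsCompact ((WithLp.toLp 2 : (Fin d → ℝ) → E d) '' Set.univ.pi fun _ => Set.Icc 0 L) :=
    (isCompact_univ_pi fun _ => isCompact_Icc).image (PiLp.continuous_toLp 2 _)
  refine hc.isBounded.subset fun y hy => ⟨y, fun i hi => ?_, rfl⟩
  exact Set.Ioo_subset_Icc_self (hy i hi)

lemma measurePreserving_proj :
    MeasurePreserving (Torus.proj d L) (volume.restrict (torusCell d L)) volume := by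
  have h1 : MeasurePreserving (WithLp.ofLp : E d → Fin d → ℝ) (volume.restrict (torusCell d L))
      (volume.restrict (Set.univ.pi fun _ => Set.Ioo 0 L)) :=
    (PiLp.volume_preserving_ofLp (Fin d)).restrict_preimage
      (MeasurableSet.univ_pi fun _ => measurableSet_Ioo)
  have h2 : MeasurePreserving (fun s : ℝ => (s : AddCircle L)) (volume.restrict (Set.Ioo 0 L))
      volume := by
    have := AddCircle.measurePreserving_mk L 0
    rwa [zero_add, ← restrict_Ioo_eq_restrict_Ioc] at this
  have h3 := measurePreserving_pi (ι := Fin d) (fun _ => (volume : Measure ℝ).restrict (Set.Ioo 0 L))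
    (fun _ => (volume : Measure (AddCircle L))) fun _ => h2
  rw [← Measure.restrict_pi_pi] at h3
  exact h3.comp h1

lemma isOpenQuotientMap_proj : IsOpenQuotientMap (Torus.proj d L) :=
  (IsOpenQuotientMap.piMap fun _ : Fin d => QuotientAddGroup.isOpenQuotientMap_mk).comp
    (PiLp.homeomorph 2 fun _ : Fin d => ℝ).isOpenQuotientMap

/-- The representative in `[0, L)^d` of a point of the torus. -/
def torusLift (x : Torus d L) : E d :=
  WithLp.toLp 2 fun i => (AddCircle.equivIco L 0 (x i) : ℝ)

lemma proj_torusLift (x : Torus d L) : Torus.proj d L (torusLift d L x) = x :=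
  funext fun _ => AddCircle.coe_equivIco

lemma torusLift_proj {y : E d} (hy : y ∈ torusCell d L) :
    torusLift d L (Torus.proj d L y) = y := by
  ext i
  have : y i ∈ Set.Ico 0 (0 + L) := by
    rw [zero_add]
    exact Set.Ioo_subset_Ico_self (hy i trivial)
  exact congrArg Subtype.val (AddCircle.equivIco_coe_eq this)

lemma proj_add (y z : E d) : Torus.proj d L (y + z) = Torus.proj d L y + Torus.proj d L z := by
  ext i
  simp [Torus.proj]

/-- A smooth function compactly supported in the fundamental cell descends to a test function. -/
lemma isTest_comp_torusLift {ψ : E d → ℝ} (hψ : ContDiff ℝ ((⊤ : ℕ∞) : WithTop ℕ∞) ψ)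
    (hψc : HasCompactSupport ψ) (hψU : tsupport ψ ⊆ torusCell d L) :
    IsTest (Torus.proj d L) fun x => ψ (torusLift d L x) := by
  have hqc := (isOpenQuotientMap_proj d L).continuous
  refine ⟨contDiff_iff_contDiffAt.2 fun y => ?_, HasCompactSupport.of_compactSpace _⟩
  by_cases hy : Torus.proj d L y ∈ Torus.proj d L '' tsupport ψ
  -- Here y' - y is a period, and near y the lifted function is ψ translated by it.
  · obtain ⟨y', hy', hyy'⟩ := hy
    have hz : ∀ z, Torus.proj d L (z + (y' - y)) = Torus.proj d L z := fun z => by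
      have h1 := proj_add d L (y' - y) y
      rw [sub_add_cancel, hyy'] at h1
      rw [proj_add, left_eq_add.1 (h1.trans (add_comm _ _)), add_zero]
    have hev : ∀ᶠ z in 𝓝 y, z + (y' - y) ∈ torusCell d L := by
      refine ContinuousAt.eventually_mem (by fun_prop) ((isOpen_torusCell d L).mem_nhds ?_)
      simpa using hψU hy'
    have hsm : ContDiffAt ℝ ((⊤ : ℕ∞) : WithTop ℕ∞) (fun z => ψ (z + (y' - y))) y :=
      (hψ.comp (contDiff_id.add contDiff_const)).contDiffAt
    refine hsm.congr_of_eventuallyEq ?_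
    filter_upwards [hev] with z hzU
    rw [← hz z, torusLift_proj d L hzU]
  -- The projected support is compact, hence closed, so off it the function vanishes near y.
  · have hcl : IsClosed (Torus.proj d L '' tsupport ψ) := (hψc.isCompact.image hqc).isClosed
    have hev : ∀ᶠ z in 𝓝 y, Torus.proj d L z ∈ (Torus.proj d L '' tsupport ψ)ᶜ :=
      hqc.continuousAt.eventually_mem (hcl.isOpen_compl.mem_nhds hy)
    refine (contDiffAt_const (c := (0 : ℝ))).congr_of_eventuallyEq ?_
    filter_upwards [hev] with z hz
    exact image_eq_zero_of_notMem_tsupport fun h => hz ⟨_, h, proj_torusLift d L _⟩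

/-- Separation by test functions is reduced to the open cell in ℝ^d: functions ψ supported there
descend to the torus, and the cell covers the torus up to a null set, as its projection preserves
measure. -/
lemma isDomainMap_proj : IsDomainMap (Torus.proj d L) where
  map_add := proj_add d L
  isOpenQuotientMap := isOpenQuotientMap_proj d L
  exists_cell := ⟨torusCell d L, (isOpen_torusCell d L).measurableSet, isBounded_torusCell d L,
    ((isOpen_torusCell d L).measure_pos volume (torusCell_nonempty d L)).ne', fun _ hH =>
      ((measurePreserving_proj d L).lintegral_comp hH).le⟩
  ae_eq_zero h hh H := by
    have hmp := measurePreserving_proj d L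
    have hhi : Integrable h := integrableOn_univ.1 (hh.integrableOn_isCompact isCompact_univ)
    have hmap : AEStronglyMeasurable h (Measure.map (Torus.proj d L)
        (volume.restrict (torusCell d L))) := by
      rw [hmp.map_eq]; exact hhi.1
    have hcomp : IntegrableOn (fun y => h (Torus.proj d L y)) (torusCell d L) :=
      hmp.integrable_comp_of_integrable hhi
    have hzero : ∀ᵐ y, y ∈ torusCell d L → h (Torus.proj d L y) = 0 := by
      refine (isOpen_torusCell d L).ae_eq_zero_of_integral_contDiff_smul_eq_zero
        hcomp.locallyIntegrableOn fun ψ hψ hψc hψU => ?_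
      have h1 := H _ (isTest_comp_torusLift d L hψ hψc hψU)
      rw [← hmp.map_eq, integral_map hmp.measurable.aemeasurable] at h1
      · rw [← h1, ← setIntegral_eq_integral_of_forall_compl_eq_zero (s := torusCell d L)]
        · refine setIntegral_congr_fun (isOpen_torusCell d L).measurableSet fun y hy => ?_
          rw [torusLift_proj d L hy]
        · intro y hy
          rw [image_eq_zero_of_notMem_tsupport fun h => hy (hψU h), zero_smul]
      · have hc : Continuous fun x => ψ (torusLift d L x) :=
          (isOpenQuotientMap_proj d L).continuous_comp_iff.1
            (isTest_comp_torusLift d L hψ hψc hψU).1.continuous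
        exact hc.aestronglyMeasurable.smul hmap
    have h0 : ∫⁻ x, ‖h x‖ₑ = 0 := by
      rw [← hmp.map_eq, lintegral_map' hmap.enorm hmp.measurable.aemeasurable,
        lintegral_eq_zero_iff' hcomp.1.enorm]
      rw [← ae_restrict_iff' (isOpen_torusCell d L).measurableSet] at hzero
      filter_upwards [hzero] with y hy
      simp [hy]
    rw [lintegral_eq_zero_iff' hhi.1.enorm] at h0
    filter_upwards [h0] with x hx
    simpa using hx

end Torus

end

end Burgers

/-- The first part is the whole space `ℝ^d`, the second part the torus `𝕋^d`. -/
theorem lemma2p6 (d : ℕ) (hd : 1 ≤ d) (p : ℝ≥0∞) [Fact (1 ≤ p)] (hdp : (d : ℝ≥0∞) < p)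
    (hp : p ≠ ∞) (ν : ℝ) (hν : 0 < ν) (T Tmax : ℝ) (hT : Tmax < T) :
    (∀ (u₀ : Lp (Burgers.E d) p (volume : Measure (Burgers.E d)))
        (f u : ℝ → Lp (Burgers.E d) p (volume : Measure (Burgers.E d))),
      Burgers.IsBoundedForce (2 * p / 3) T f →
      Burgers.IsMaximalMildSolution id ν u₀ T f Tmax u →
      limsup (fun t => ‖u t‖ₑ ^ 2) (𝓝[<] Tmax) = ∞) ∧
    (∀ (L : ℝ) [Fact (0 < L)] (u₀ : Lp (Burgers.E d) p (volume : Measure (Burgers.Torus d L)))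
        (f u : ℝ → Lp (Burgers.E d) p (volume : Measure (Burgers.Torus d L))),
      Burgers.IsBoundedForce (2 * p / 3) T f →
      Burgers.IsMaximalMildSolution (Burgers.Torus.proj d L) ν u₀ T f Tmax u →
      limsup (fun t => ‖u t‖ₑ ^ 2) (𝓝[<] Tmax) = ∞) := by
  exact ⟨fun _ _ _ hf hu =>
      Burgers.limsup_enorm_sq_eq_top hp hdp (Burgers.isDomainMap_id d) hν hT hf hu,
    fun L _ _ _ _ hf hu =>
      Burgers.limsup_enorm_sq_eq_top hp hdp (Burgers.isDomainMap_proj d L) hν hT hf hu⟩
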